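/- Let $q,s\ge 0$ be integers, let $\tau>0$, and let $V_1,\dots,V_s\in\mathbb Z^q$ be linearly independent vectors spanning the subspace $L$ of $\mathbb R^q$. For $w\in\mathbb Z^s$ let $B_w:=\{\sum_a t_aV_a : t\in\mathbb R^s,\ \lfloor t_a\rfloor=w_a \text{ for all } a\}$. For $\lambda=(\lambda_1,\dots,\lambda_q)\in[0,\infty)^q$ put $\nu:=\sum_i\lambda_i$ and $D:=\mathrm{diag}(\sqrt{\lambda_1},\dots,\sqrt{\lambda_q})$; let $Y=(Y_1,\dots,Y_q)$ have independent coordinates $Y_i\sim\mathrm{Poisson}(\lambda_i)$, let $X:=D^{-1}(Y-\lambda)$, and let $\mathbb Q$ denote expectation under $\mathbb P(\,\cdot\mid Y\in\lambda+L)$. Let $\mathcal N_\lambda$ be the normal distribution on the subspace $D^{-1}L$ with density $(2\pi)^{-s/2}e^{-|x|^2/2}$ with respect to Lebesgue measure on $D^{-1}L$. Let $g:[0,\infty)\to\mathbb R$ be uniformly continuous and increasing (in the weak sense). Then for every $\theta>1$ there exist $\delta>0$, $\eta>0$ and $\nu_0$ (depending only on $\theta$, $g$, $\tau$ and $V_1,\dots,V_s$)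 such that for every $\lambda$ with $$\nu\ge\nu_0,\qquad \min_i\lambda_i\ge\tau\nu,\qquad \mathbb Z^q\cap(\lambda+L)\ne\emptyset,$$ the event $\{Y\in\lambda+L\}$ has positive probability and the set $$L_\delta:=\bigcup\{B_w : w\in\mathbb Z^s,\ \max_a|w_a|\le\eta\nu\}\subseteq L$$ satisfies (i) $\{x\in D^{-1}L : |x|\le\delta\sqrt\nu\}\subseteq D^{-1}L_\delta$; (ii) $\mathbb Q\big[\exp(g(|X|^2))\,\mathbf 1\{X\in D^{-1}L_\delta\}\big]\le\theta\,\mathcal N_\lambda\big[\exp(g(\theta^2|x|^2))\,\mathbf 1\{x\in\theta^{-1}D^{-1}L_\delta\}\big]$. -/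

import Mathlib

open MeasureTheory ProbabilityTheory
open scoped NNReal ENNReal

noncomputable section

/-- The total `ν = ∑ i, λ i` of the Poisson means. -/
def totalMean {q : ℕ} (lam : Fin q → ℝ≥0) : ℝ := ∑ i, (lam i : ℝ)

/-- The vector of means `λ` as a point of Euclidean space `ℝ^q`. -/
def meanVec {q : ℕ} (lam : Fin q → ℝ≥0) : EuclideanSpace ℝ (Fin q) :=
  WithLp.toLp 2 fun i => (lam i : ℝ)

/-- An integer vector as a point of Euclidean space `ℝ^q`. -/
def intVec {q : ℕ} (v : Fin q → ℤ) : EuclideanSpace ℝ (Fin q) :=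
  WithLp.toLp 2 fun i => (v i : ℝ)

/-- A vector of counts as a point of Euclidean space `ℝ^q`. -/
def countVec {q : ℕ} (y : Fin q → ℕ) : EuclideanSpace ℝ (Fin q) :=
  WithLp.toLp 2 fun i => (y i : ℝ)

/-- The linear map `D⁻¹`, where `D = diag (√λ 1, …, √λ q)`. -/
def invD {q : ℕ} (lam : Fin q → ℝ≥0) :
    EuclideanSpace ℝ (Fin q) →ₗ[ℝ] EuclideanSpace ℝ (Fin q) where
  toFun x := WithLp.toLp 2 fun i => x i / Real.sqrt (lam i)
  map_add' x y := by ext i; simp [add_div]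
  map_smul' c x := by ext i; simp [mul_div_assoc]

/-- The standardized vector `X = D⁻¹ (Y - λ)`. -/
def stdVec {q : ℕ} (lam : Fin q → ℝ≥0) (y : Fin q → ℕ) : EuclideanSpace ℝ (Fin q) :=
  invD lam (countVec y - meanVec lam)

/-- The subspace `L` of `ℝ^q` spanned by the integer vectors `V 1, …, V s`. -/
def latticeSpan {q s : ℕ} (V : Fin s → Fin q → ℤ) : Submodule ℝ (EuclideanSpace ℝ (Fin q)) :=
  Submodule.span ℝ (Set.range fun a => intVec (V a))

/-- The box `B_w = {∑ t_a V_a : ⌊t_a⌋ = w_a for all a}`. -/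
def latticeBox {q s : ℕ} (V : Fin s → Fin q → ℤ) (w : Fin s → ℤ) :
    Set (EuclideanSpace ℝ (Fin q)) :=
  {x | ∃ t : Fin s → ℝ, (∀ a, ⌊t a⌋ = w a) ∧ x = ∑ a, t a • intVec (V a)}

/-- The union of the boxes `B_w` over all `w ∈ ℤ^s` with `max_a |w_a| ≤ r`. -/
def boxRegion {q s : ℕ} (V : Fin s → Fin q → ℤ) (r : ℝ) : Set (EuclideanSpace ℝ (Fin q)) :=
  ⋃ w ∈ {w : Fin s → ℤ | ∀ a, |(w a : ℝ)| ≤ r}, latticeBox V w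

/-- The joint law of independent `Y i ∼ Poisson (λ i)`. -/
def poissonLaw {q : ℕ} (lam : Fin q → ℝ≥0) : Measure (Fin q → ℕ) :=
  Measure.pi fun i => poissonMeasure (lam i)

/-- The event `{Y ∈ λ ⊕ L}`. -/
def linearEvent {q : ℕ} (lam : Fin q → ℝ≥0) (L : Submodule ℝ (EuclideanSpace ℝ (Fin q))) :
    Set (Fin q → ℕ) :=
  {y | countVec y - meanVec lam ∈ L}

/-- The conditional law of `Y` given `Y ∈ λ ⊕ L`. -/
def condLaw {q : ℕ} (lam : Fin q → ℝ≥0) (L : Submodule ℝ (EuclideanSpace ℝ (Fin q))) :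
    Measure (Fin q → ℕ) :=
  ProbabilityTheory.cond (poissonLaw lam) (linearEvent lam L)

/-- The standard normal distribution on a subspace `E` of `ℝ^q`, as a measure on `ℝ^q` carried
by `E`: it has density `(2π)^(-dim E / 2) exp (-|x|² / 2)` with respect to Lebesgue measure on `E`
(the Haar measure giving mass one to the unit cube of an orthonormal basis of `E`). -/
def subspaceGaussian {q : ℕ} (E : Submodule ℝ (EuclideanSpace ℝ (Fin q))) :
    Measure (EuclideanSpace ℝ (Fin q)) :=
  ((stdOrthonormalBasis ℝ E).toBasis.addHaar.withDensity fun x : E =>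
    ENNReal.ofReal ((2 * Real.pi) ^ (-(Module.finrank ℝ E : ℝ) / 2)
      * Real.exp (-‖x‖ ^ 2 / 2))).map Subtype.val

/-- The normal distribution `N_λ` on the subspace `D⁻¹ L`. -/
def limitNormal {q : ℕ} (lam : Fin q → ℝ≥0) (L : Submodule ℝ (EuclideanSpace ℝ (Fin q))) :
    Measure (EuclideanSpace ℝ (Fin q)) :=
  subspaceGaussian (L.map (invD lam))

end

/-! By Stirling's formula a Poisson weight close to its mean is a Gaussian weight, up to a factor
`exp (±ε)` and a relative error `ε` in the quadratic exponent
(`exists_poissonLaw_singleton_bounds`). Translation by an integer combination of the `V a` maps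
integer points of one box to those of another, so all boxes in the region contain the same number `k
> 0` of count vectors (`exists_encard_boxCounts`). In the coordinates `t` with `Φ t = D⁻¹ ∑ t_a
V_a`, boxes are unit cubes, and a sum over count vectors is compared with `k` times an integral over
cubes. Within a cube `Φ t` moves by at most a small `ρ` once `ν` is large; the induced change of `g
(|x|²)` and of `|x|²` is `O(ε + ε |x|²)` (`exists_modulus_sq`), again absorbed into the exponent.

The conditional expectation is a quotient. Its numerator is bounded above and the probability of the
conditioning event below, each with the factor `k * gaussNorm lam`, which cancels, so neither `k`
nor the lattice determinant is computed. What remains is Gaussian. For the denominator, the slightly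
sharpened Gaussian on the region keeps nearly all the mass (`exists_gaussMass_le`). For the
numerator, the slightly flattened exponent must be beaten by variance `θ²`: near the origin a
dilation together with monotonicity of `g` suffices, and far out the gap between the exponents does
(`exists_setLIntegral_exp_le`). The substitution `t ↦ θ t` turns variance `θ²` into the right-hand
side of (ii). The two Gaussian losses and the local limit loss `exp (6ε)` are each at most `a`, with
`a ^ 3 ≤ θ`. -/

/-! ### Local limit bounds for Poisson weights. -/

/-- The function is the large-deviation rate of the Poisson law at relative deviation `z`. Its
Taylor remainder after the quadratic term is cubic, hence small relative to `z ^ 2`. -/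
theorem exists_abs_entropy_sub_le (ε : ℝ) (hε : 0 < ε) :
    ∃ δ : ℝ, 0 < δ ∧ δ ≤ 1 / 2 ∧ ∀ z : ℝ, |z| ≤ δ →
      |(1 + z) * Real.log (1 + z) - z - z ^ 2 / 2| ≤ ε * (z ^ 2 / 2) := by
  -- The remainder below is at most `7 / 2 * |z| ^ 3`, whence the 7.
  refine ⟨min (1 / 2) (ε / 7), by positivity, min_le_left _ _, fun z hz => ?_⟩
  have h1 : |z| ≤ 1 / 2 := hz.trans (min_le_left _ _)
  have h2 : |z| ≤ ε / 7 := hz.trans (min_le_right _ _)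
  have h3 := Real.abs_log_sub_add_sum_range_le (x := -z) (by rw [abs_neg]; linarith) 2
  simp only [Finset.sum_range_succ, Finset.sum_range_zero, abs_neg, sub_neg_eq_add] at h3
  norm_num at h3
  set r := -z + z ^ 2 / 2 + Real.log (1 + z) with hr
  have h4 : |r| ≤ 2 * |z| ^ 3 := by
    refine h3.trans ?_
    rw [div_le_iff₀ (by linarith)]
    nlinarith [pow_nonneg (abs_nonneg z) 3]
  have h5 : (1 + z) * Real.log (1 + z) - z - z ^ 2 / 2 = -(z ^ 3 / 2) + (1 + z) * r := by
    rw [hr]; ring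
  rw [h5]
  have h6 : |1 + z| ≤ 3 / 2 := by
    rw [abs_le] at h1 ⊢; constructor <;> linarith
  calc |-(z ^ 3 / 2) + (1 + z) * r| ≤ |-(z ^ 3 / 2)| + |(1 + z) * r| := abs_add_le _ _
    _ = |z| ^ 3 / 2 + |1 + z| * |r| := by
        rw [abs_neg, abs_div, abs_mul, abs_pow, abs_of_pos (by norm_num : (0 : ℝ) < 2)]
    _ ≤ |z| ^ 3 / 2 + 3 / 2 * (2 * |z| ^ 3) := by gcongr
    _ = 7 / 2 * |z| * z ^ 2 := by rw [← sq_abs z]; ring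
    _ ≤ 7 / 2 * (ε / 7) * z ^ 2 := by gcongr
    _ = ε * (z ^ 2 / 2) := by ring

/-- The logarithm of the Poisson weight, up to the Gaussian approximation. -/
theorem exists_abs_log_poisson_le (ε : ℝ) (hε : 0 < ε) :
    ∃ δ : ℝ, 0 < δ ∧ δ ≤ 1 / 2 ∧ ∃ M : ℝ, 0 < M ∧ ∀ (r : ℝ) (n : ℕ), M ≤ r → |(n : ℝ) - r| ≤ δ * r →
      |Real.log (Real.exp (-r) * r ^ n / n.factorial) + Real.log (2 * Real.pi * r) / 2
        + ((n : ℝ) - r) ^ 2 / (2 * r)| ≤ ε + ε * (((n : ℝ) - r) ^ 2 / (2 * r)) := by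
  obtain ⟨δ₁, hδ₁, hδ₁', H₁⟩ := exists_abs_entropy_sub_le ε hε
  have hlog : Filter.Tendsto (fun n => Real.log (Stirling.stirlingSeq n)) Filter.atTop
      (nhds (Real.log (√Real.pi))) :=
    (Real.continuousAt_log (by positivity)).tendsto.comp Stirling.tendsto_stirlingSeq_sqrt_pi
  obtain ⟨N, hN⟩ := (Metric.tendsto_atTop.1 hlog) (ε / 2) (by positivity)
  have hcont : Filter.Tendsto (fun z : ℝ => Real.log (1 + z)) (nhds 0) (nhds (Real.log (1 + 0))) :=
    (Real.continuousAt_log (by norm_num)).tendsto.comp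
      ((continuous_const.add continuous_id).tendsto (0 : ℝ))
  obtain ⟨δ₂, hδ₂, H₂⟩ := (Metric.tendsto_nhds_nhds.1 hcont) ε hε
  -- Since `n ≥ r / 2`, the bound `r ≥ 2 * (N + 1)` puts `n` in the range where Stirling's formula
  -- is accurate. Halving `δ₂` yields a strict inequality.
  refine ⟨min δ₁ (δ₂ / 2), by positivity, (min_le_left _ _).trans hδ₁', 2 * (N + 1), by positivity,
    fun r n hr hn => ?_⟩
  have hr0 : 0 < r := lt_of_lt_of_le (by positivity) hr
  set z := ((n : ℝ) - r) / r with hz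
  have hzabs : |z| ≤ min δ₁ (δ₂ / 2) := by
    rw [hz, abs_div, abs_of_pos hr0, div_le_iff₀ hr0]; exact hn
  have hnz : (n : ℝ) = r * (1 + z) := by rw [hz]; field_simp; ring
  have hz1 : |z| ≤ 1 / 2 := hzabs.trans ((min_le_left _ _).trans hδ₁')
  have hz2 : 1 / 2 ≤ 1 + z := by rw [abs_le] at hz1; linarith
  have hnN : N ≤ n := by
    have : (N : ℝ) + 1 ≤ n := by rw [hnz]; nlinarith
    exact_mod_cast (by linarith : (N : ℝ) ≤ n)
  have hn0 : (0 : ℝ) < n := by rw [hnz]; positivity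
  have e1 := H₁ z (hzabs.trans (min_le_left _ _))
  have e2 := H₂ (x := z) (by
    rw [Real.dist_eq, sub_zero]; exact lt_of_le_of_lt (hzabs.trans (min_le_right _ _)) (by linarith))
  have e3 := hN n hnN
  rw [Real.dist_eq] at e2 e3
  have hs : Real.log (Stirling.stirlingSeq n) = Real.log n.factorial
      - (Real.log 2 / 2 + Real.log n / 2 + n * (Real.log n - 1)) := by
    rw [Stirling.log_stirlingSeq_formula, Real.log_mul (by norm_num) hn0.ne',
      Real.log_div hn0.ne' (Real.exp_ne_zero _), Real.log_exp]
    ring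
  have hlogn : Real.log n = Real.log r + Real.log (1 + z) := by
    rw [hnz, Real.log_mul hr0.ne' (by linarith)]
  have hpi : Real.log (√Real.pi) = Real.log Real.pi / 2 := Real.log_sqrt Real.pi_pos.le
  have hp : Real.log (Real.exp (-r) * r ^ n / n.factorial)
      = -r + n * Real.log r - Real.log n.factorial := by
    rw [Real.log_div (by positivity) (by positivity), Real.log_mul (by positivity) (by positivity),
      Real.log_exp, Real.log_pow]
  have hsq : ((n : ℝ) - r) ^ 2 / (2 * r) = r * (z ^ 2 / 2) := by
    rw [hz]; field_simp
  have h2pi : Real.log (2 * Real.pi * r) = Real.log 2 + Real.log Real.pi + Real.log r := by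
    rw [Real.log_mul (by positivity) hr0.ne', Real.log_mul (by norm_num) Real.pi_pos.ne']
  -- The error splits exactly into the cubic part of the rate function, the Stirling error, and the
  -- effect of replacing `n` by `r` under the square root.
  have key : Real.log (Real.exp (-r) * r ^ n / n.factorial) + Real.log (2 * Real.pi * r) / 2
        + ((n : ℝ) - r) ^ 2 / (2 * r)
      = -(r * ((1 + z) * Real.log (1 + z) - z - z ^ 2 / 2))
        - (Real.log (Stirling.stirlingSeq n) - Real.log (√Real.pi))
        - (Real.log (1 + z) - Real.log (1 + 0)) / 2 := by
    rw [hp, h2pi, hs, hpi, hlogn, hsq, add_zero, Real.log_one, hnz]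
    ring
  rw [key, hsq]
  have e1' : |r * ((1 + z) * Real.log (1 + z) - z - z ^ 2 / 2)| ≤ ε * (r * (z ^ 2 / 2)) := by
    rw [abs_mul, abs_of_pos hr0]
    calc _ ≤ r * (ε * (z ^ 2 / 2)) := by gcongr
      _ = _ := by ring
  clear_value z
  generalize r * ((1 + z) * Real.log (1 + z) - z - z ^ 2 / 2) = a at *
  generalize Real.log (1 + z) - Real.log (1 + 0) = b at *
  generalize Real.log (Stirling.stirlingSeq n) - Real.log (√Real.pi) = c at *
  obtain ⟨a1, a2⟩ := abs_le.1 e1'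
  obtain ⟨b1, b2⟩ := abs_lt.1 e2
  obtain ⟨c1, c2⟩ := abs_lt.1 e3
  exact abs_le.2 ⟨by linarith, by linarith⟩

/-- The normalizing factor `∏ i, (2π λ i)^(-1/2)` of the Gaussian approximation of a vector of
independent Poisson variables. -/
noncomputable def gaussNorm {q : ℕ} (lam : Fin q → ℝ≥0) : ℝ :=
  Real.exp (-∑ i, Real.log (2 * Real.pi * lam i) / 2)

theorem gaussNorm_pos {q : ℕ} (lam : Fin q → ℝ≥0) : 0 < gaussNorm lam := Real.exp_pos _

theorem norm_stdVec_sq {q : ℕ} (lam : Fin q → ℝ≥0) (y : Fin q → ℕ) :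
    ‖stdVec lam y‖ ^ 2 = ∑ i, ((y i : ℝ) - lam i) ^ 2 / lam i := by
  rw [EuclideanSpace.norm_sq_eq]
  refine Finset.sum_congr rfl fun i _ => ?_
  simp [stdVec, invD, countVec, meanVec, div_pow]

theorem poissonLaw_singleton {q : ℕ} (lam : Fin q → ℝ≥0) (y : Fin q → ℕ) :
    poissonLaw lam {y} = ENNReal.ofReal
      (∏ i, (Real.exp (-lam i) * (lam i : ℝ) ^ (y i) / (y i).factorial)) := by
  rw [poissonLaw, Measure.pi_singleton, ENNReal.ofReal_prod_of_nonneg (fun i _ => by positivity)]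
  simp_rw [poissonMeasure_singleton]

/-- A two-sided local limit bound for vectors of independent Poisson variables. -/
theorem exists_poissonLaw_singleton_bounds (q : ℕ) (ε : ℝ) (hε : 0 < ε) :
    ∃ δ : ℝ, 0 < δ ∧ δ ≤ 1 / 2 ∧ ∃ M : ℝ, 0 < M ∧ ∀ (lam : Fin q → ℝ≥0) (y : Fin q → ℕ),
      (∀ i, M ≤ lam i) → (∀ i, |(y i : ℝ) - lam i| ≤ δ * lam i) →
      poissonLaw lam {y} ≤ ENNReal.ofReal
        (gaussNorm lam * Real.exp (ε - (1 - ε) * ‖stdVec lam y‖ ^ 2 / 2)) ∧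
      ENNReal.ofReal (gaussNorm lam * Real.exp (-ε - (1 + ε) * ‖stdVec lam y‖ ^ 2 / 2))
        ≤ poissonLaw lam {y} := by
  have hq : (0 : ℝ) < q + 1 := by positivity
  -- The constant errors of `q` coordinates add up to at most `ε`; `q + 1` keeps the quotient
  -- positive when `q = 0`.
  obtain ⟨δ, hδ, hδ', M, hM, H⟩ := exists_abs_log_poisson_le (ε / (q + 1)) (by positivity)
  refine ⟨δ, hδ, hδ', M, hM, fun lam y h1 h2 => ?_⟩
  have hpos : ∀ i, (0 : ℝ) < lam i := fun i => hM.trans_le (h1 i)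
  set p : Fin q → ℝ := fun i => Real.exp (-lam i) * (lam i : ℝ) ^ (y i) / (y i).factorial with hp
  have hp0 : ∀ i, 0 < p i := fun i => by have := hpos i; positivity
  have hprod : ∏ i, p i = Real.exp (∑ i, Real.log (p i)) := by
    rw [Real.exp_sum]
    exact Finset.prod_congr rfl fun i _ => (Real.exp_log (hp0 i)).symm
  set S := ∑ i, ((y i : ℝ) - lam i) ^ 2 / (2 * lam i) with hS
  have hnorm : ‖stdVec lam y‖ ^ 2 / 2 = S := by
    rw [norm_stdVec_sq, Finset.sum_div]
    refine Finset.sum_congr rfl fun i _ => ?_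
    rw [div_div, mul_comm]
  have hS0 : 0 ≤ S := by rw [← hnorm]; positivity
  have hsum : |∑ i, Real.log (p i) + ∑ i, Real.log (2 * Real.pi * lam i) / 2 + S| ≤ ε + ε * S := by
    rw [hS, ← Finset.sum_add_distrib, ← Finset.sum_add_distrib]
    refine (Finset.abs_sum_le_sum_abs _ _).trans ?_
    refine (Finset.sum_le_sum fun i _ => H (lam i) (y i) (h1 i) (h2 i)).trans ?_
    rw [Finset.sum_add_distrib, ← Finset.mul_sum, Finset.sum_const, Finset.card_univ,
      Fintype.card_fin, nsmul_eq_mul]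
    have e : ε / (q + 1) ≤ ε := div_le_self hε.le (by linarith [(Nat.cast_nonneg q : (0 : ℝ) ≤ q)])
    have e' : (q : ℝ) * (ε / (q + 1)) ≤ ε := by
      rw [mul_div_assoc', div_le_iff₀ hq]; nlinarith
    gcongr
  rw [abs_le] at hsum
  rw [poissonLaw_singleton, ← hp, hprod, gaussNorm, ← Real.exp_add, ← Real.exp_add]
  constructor
  · refine ENNReal.ofReal_le_ofReal (Real.exp_le_exp.2 ?_)
    rw [mul_div_assoc, hnorm]; linarith [hsum.2]
  · refine ENNReal.ofReal_le_ofReal (Real.exp_le_exp.2 ?_)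
    rw [mul_div_assoc, hnorm]; linarith [hsum.1]

/-! ### Lattice boxes: counting points, and sums against integrals. -/

section Lattice

variable {q s : ℕ}

/-- The linear map `t ↦ ∑ t_a V_a`. -/
noncomputable def latticeMap (V : Fin s → Fin q → ℤ) :
    (Fin s → ℝ) →ₗ[ℝ] EuclideanSpace ℝ (Fin q) :=
  Fintype.linearCombination ℝ fun a => intVec (V a)

theorem latticeMap_apply (V : Fin s → Fin q → ℤ) (t : Fin s → ℝ) :
    latticeMap V t = ∑ a, t a • intVec (V a) := rfl

theorem range_latticeMap (V : Fin s → Fin q → ℤ) :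
    LinearMap.range (latticeMap V) = latticeSpan V :=
  Fintype.range_linearCombination ℝ (fun a => intVec (V a))

theorem latticeMap_injective (V : Fin s → Fin q → ℤ)
    (hV : LinearIndependent ℝ fun a => intVec (V a)) : Function.Injective (latticeMap V) :=
  hV.fintypeLinearCombination_injective

/-- The half-open unit cube with integral corner `w`. -/
def unitCube (w : Fin s → ℤ) : Set (Fin s → ℝ) := {t | ∀ a, ⌊t a⌋ = w a}

/-- The union of the unit cubes whose corners have coordinates bounded by `r`. -/
def cubeRegion (s : ℕ) (r : ℝ) : Set (Fin s → ℝ) := {t | ∀ a, |((⌊t a⌋ : ℤ) : ℝ)| ≤ r}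

theorem unitCube_eq_pi (w : Fin s → ℤ) :
    unitCube w = Set.univ.pi fun a => Set.Ico (w a : ℝ) (w a + 1) := by
  ext t
  simp [unitCube, Int.floor_eq_iff]

theorem measurableSet_unitCube (w : Fin s → ℤ) : MeasurableSet (unitCube w) := by
  rw [unitCube_eq_pi]
  exact MeasurableSet.univ_pi fun _ => measurableSet_Ico

theorem volume_unitCube (w : Fin s → ℤ) : volume (unitCube w) = 1 := by
  rw [unitCube_eq_pi, volume_pi_pi]
  simp

theorem cubeRegion_eq_biUnion (r : ℝ) :
    cubeRegion s r = ⋃ w ∈ {w : Fin s → ℤ | ∀ a, |(w a : ℝ)| ≤ r}, unitCube w := by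
  ext t
  simp only [cubeRegion, unitCube, Set.mem_ofPred_eq, Set.mem_iUnion, exists_prop]
  constructor
  · exact fun h => ⟨fun a => ⌊t a⌋, h, fun _ => rfl⟩
  · rintro ⟨w, hw, h⟩ a
    rw [h a]; exact hw a

theorem measurableSet_cubeRegion (r : ℝ) : MeasurableSet (cubeRegion s r) := by
  rw [cubeRegion_eq_biUnion]
  exact MeasurableSet.biUnion (Set.to_countable _) fun w _ => measurableSet_unitCube w

theorem latticeBox_eq_image (V : Fin s → Fin q → ℤ) (w : Fin s → ℤ) :
    latticeBox V w = latticeMap V '' unitCube w := by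
  ext x
  simp only [latticeBox, unitCube, Set.mem_ofPred_eq, Set.mem_image, latticeMap_apply]
  exact ⟨fun ⟨t, h, e⟩ => ⟨t, h, e.symm⟩, fun ⟨t, h, e⟩ => ⟨t, h, e.symm⟩⟩

theorem boxRegion_eq_image (V : Fin s → Fin q → ℤ) (r : ℝ) :
    boxRegion V r = latticeMap V '' cubeRegion s r := by
  rw [cubeRegion_eq_biUnion, Set.image_iUnion₂, boxRegion]
  simp_rw [latticeBox_eq_image]

/-- The count vectors in the box with corner `w`, centred at the vector of means. -/
def boxCounts (lam : Fin q → ℝ≥0) (V : Fin s → Fin q → ℤ) (w : Fin s → ℤ) : Set (Fin q → ℕ) :=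
  {y | countVec y - meanVec lam ∈ latticeBox V w}

/-- The integer vectors in the box with corner `w`, centred at the vector of means. -/
def boxIntegers (lam : Fin q → ℝ≥0) (V : Fin s → Fin q → ℤ) (w : Fin s → ℤ) :
    Set (Fin q → ℤ) :=
  {y | intVec y - meanVec lam ∈ latticeBox V w}

theorem intVec_add_sum (V : Fin s → Fin q → ℤ) (w : Fin s → ℤ) (y : Fin q → ℤ) :
    intVec (fun i => y i + ∑ a, w a * V a i) = intVec y + latticeMap V fun a => (w a : ℝ) := by
  ext i
  simp [intVec, latticeMap_apply]

/-- Integer translations by `∑ w_a V_a` preserve `ℤ^q`, because the `V a` are integral, and permute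
the boxes. This is what makes the counts equal. -/
theorem boxIntegers_eq_image (lam : Fin q → ℝ≥0) (V : Fin s → Fin q → ℤ) (w : Fin s → ℤ) :
    boxIntegers lam V w
      = (fun y i => y i + ∑ a, w a * V a i) '' boxIntegers lam V 0 := by
  have shift : ∀ (u v : Fin s → ℤ) (y : Fin q → ℤ), y ∈ boxIntegers lam V u →
      (fun i => y i + ∑ a, v a * V a i) ∈ boxIntegers lam V (u + v) := by
    intro u v y hy
    simp only [boxIntegers, latticeBox_eq_image, Set.mem_ofPred_eq, intVec_add_sum] at hy ⊢
    obtain ⟨t, ht, e⟩ := hy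
    refine ⟨t + fun a => (v a : ℝ), fun a => ?_, ?_⟩
    · simp [ht a]
    · rw [map_add, e]; abel
  ext y
  constructor
  · intro hy
    refine ⟨fun i => y i + ∑ a, (-w) a * V a i, ?_, ?_⟩
    · simpa using shift w (-w) y hy
    · ext i; simp
  · rintro ⟨y, hy, rfl⟩
    simpa using shift 0 w y hy

theorem encard_boxIntegers (lam : Fin q → ℝ≥0) (V : Fin s → Fin q → ℤ) (w : Fin s → ℤ) :
    (boxIntegers lam V w).encard = (boxIntegers lam V 0).encard := by
  rw [boxIntegers_eq_image]
  refine Function.Injective.encard_image (fun y z h => ?_) _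
  ext i
  simpa using congrFun h i

theorem exists_norm_latticeMap_le (V : Fin s → Fin q → ℤ) :
    ∃ K : ℝ, 0 < K ∧ ∀ t, ‖latticeMap V t‖ ≤ K * ‖t‖ := by
  refine ⟨‖(latticeMap V).toContinuousLinearMap‖ + 1, by positivity, fun t => ?_⟩
  have := (latticeMap V).toContinuousLinearMap.le_opNorm t
  rw [LinearMap.coe_toContinuousLinearMap'] at this
  nlinarith [norm_nonneg t]

theorem exists_norm_le_latticeMap (V : Fin s → Fin q → ℤ)
    (hV : LinearIndependent ℝ fun a => intVec (V a)) :
    ∃ K : ℝ, 0 < K ∧ ∀ t, ‖t‖ ≤ K * ‖latticeMap V t‖ := by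
  obtain ⟨K, hK, h⟩ := (latticeMap V).exists_antilipschitzWith
    (LinearMap.ker_eq_bot.2 (latticeMap_injective V hV))
  refine ⟨K, by exact_mod_cast hK, fun t => ?_⟩
  simpa using h.le_mul_dist t 0

theorem finite_boxIntegers_zero (lam : Fin q → ℝ≥0) (V : Fin s → Fin q → ℤ) :
    (boxIntegers lam V 0).Finite := by
  obtain ⟨K, hK, h⟩ := exists_norm_latticeMap_le V
  refine (Set.finite_Icc (fun i => ⌊(lam i : ℝ) - K⌋) (fun i => ⌈(lam i : ℝ) + K⌉)).subset ?_
  intro y hy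
  simp only [boxIntegers, latticeBox_eq_image, Set.mem_ofPred_eq] at hy
  obtain ⟨t, ht, e⟩ := hy
  have ht1 : ‖t‖ ≤ 1 := by
    refine (pi_norm_le_iff_of_nonneg zero_le_one).2 fun a => ?_
    have := ht a
    rw [Int.floor_eq_iff] at this
    simp only [Pi.zero_apply, Int.cast_zero, zero_add] at this
    rw [Real.norm_eq_abs, abs_of_nonneg this.1]; exact this.2.le
  have hx : ∀ i, |(y i : ℝ) - lam i| ≤ K := fun i => by
    have e1 := PiLp.norm_apply_le (latticeMap V t) i
    rw [e] at e1
    refine (le_trans e1 ?_)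
    rw [← e]
    nlinarith [h t]
  constructor
  · intro i
    have := (abs_le.1 (hx i)).1
    exact_mod_cast (Int.floor_le _).trans (by linarith : (lam i : ℝ) - K ≤ y i)
  · intro i
    have := (abs_le.1 (hx i)).2
    exact_mod_cast (by linarith : (y i : ℝ) ≤ lam i + K).trans (Int.le_ceil _)

theorem nonempty_boxIntegers_zero (lam : Fin q → ℝ≥0) (V : Fin s → Fin q → ℤ)
    (h : ∃ m : Fin q → ℤ, intVec m - meanVec lam ∈ latticeSpan V) :
    (boxIntegers lam V 0).Nonempty := by
  obtain ⟨m, hm⟩ := h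
  rw [← range_latticeMap] at hm
  obtain ⟨t, ht⟩ := hm
  have : m ∈ boxIntegers lam V fun a => ⌊t a⌋ := by
    simp only [boxIntegers, latticeBox_eq_image, Set.mem_ofPred_eq]
    exact ⟨t, fun _ => rfl, ht⟩
  rw [boxIntegers_eq_image] at this
  exact (Set.image_nonempty.1 ⟨m, this⟩)

/-- Every box inside the positive orthant contains the same number of count vectors. -/
theorem exists_encard_boxCounts (lam : Fin q → ℝ≥0) (V : Fin s → Fin q → ℤ) (r : ℝ)
    (h : ∃ m : Fin q → ℤ, intVec m - meanVec lam ∈ latticeSpan V)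
    (hr : ∀ x ∈ boxRegion V r, ∀ i, -(lam i : ℝ) ≤ x i) :
    ∃ k : ℕ, 0 < k ∧ ∀ w : Fin s → ℤ, (∀ a, |(w a : ℝ)| ≤ r) →
      (boxCounts lam V w).encard = k := by
  refine ⟨(boxIntegers lam V 0).ncard,
    (Set.ncard_pos (finite_boxIntegers_zero lam V)).2 (nonempty_boxIntegers_zero lam V h),
    fun w hw => ?_⟩
  rw [(finite_boxIntegers_zero lam V).cast_ncard_eq, ← encard_boxIntegers lam V w]
  have hinj : Function.Injective fun (y : Fin q → ℕ) i => (y i : ℤ) := fun y z e => by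
    ext i; exact Int.ofNat_inj.1 (congrFun e i)
  rw [← hinj.encard_image]
  congr 1
  ext y
  constructor
  · rintro ⟨y, hy, rfl⟩
    simpa [boxCounts, boxIntegers, countVec, intVec] using hy
  · intro hy
    -- The orthant condition is what identifies integer points of the box with vectors of natural
    -- numbers.
    have h0 : ∀ i, 0 ≤ y i := fun i => by
      have := hr _ (Set.mem_biUnion (show w ∈ {w : Fin s → ℤ | ∀ a, |(w a : ℝ)| ≤ r} from hw) hy) i
      simp only [intVec, meanVec, PiLp.sub_apply] at this
      exact_mod_cast (by linarith : (0 : ℝ) ≤ y i)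
    lift y to Fin q → ℕ using h0
    exact ⟨y, by simpa [boxCounts, boxIntegers, countVec, intVec] using hy, rfl⟩

theorem setOf_mem_boxRegion_eq_biUnion (lam : Fin q → ℝ≥0) (V : Fin s → Fin q → ℤ) (r : ℝ) :
    {y | countVec y - meanVec lam ∈ boxRegion V r}
      = ⋃ w ∈ {w : Fin s → ℤ | ∀ a, |(w a : ℝ)| ≤ r}, boxCounts lam V w := by
  ext y
  simp [boxRegion, boxCounts]

theorem pairwiseDisjoint_unitCube (W : Set (Fin s → ℤ)) : W.PairwiseDisjoint unitCube := by
  intro w _ w' _ hne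
  refine Set.disjoint_left.2 fun t h h' => hne ?_
  ext a
  rw [← h a, ← h' a]

theorem pairwiseDisjoint_boxCounts (lam : Fin q → ℝ≥0) (V : Fin s → Fin q → ℤ)
    (hV : LinearIndependent ℝ fun a => intVec (V a)) (W : Set (Fin s → ℤ)) :
    W.PairwiseDisjoint (boxCounts lam V) := by
  intro w _ w' _ hne
  refine Set.disjoint_left.2 fun y h h' => hne ?_
  simp only [boxCounts, latticeBox_eq_image, Set.mem_ofPred_eq] at h h'
  obtain ⟨t, ht, e⟩ := h
  obtain ⟨t', ht', e'⟩ := h'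
  obtain rfl := latticeMap_injective V hV (e.trans e'.symm)
  ext a
  rw [← ht a, ← ht' a]

theorem setLIntegral_boxRegion_eq_tsum (lam : Fin q → ℝ≥0) (V : Fin s → Fin q → ℤ)
    (hV : LinearIndependent ℝ fun a => intVec (V a)) (r : ℝ) (f : (Fin q → ℕ) → ℝ≥0∞) :
    ∫⁻ y in {y | countVec y - meanVec lam ∈ boxRegion V r}, f y ∂(poissonLaw lam)
      = ∑' w : {w : Fin s → ℤ | ∀ a, |(w a : ℝ)| ≤ r}, ∑' y : boxCounts lam V w,
          f y * poissonLaw lam {(y : Fin q → ℕ)} := by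
  rw [setOf_mem_boxRegion_eq_biUnion, lintegral_biUnion (Set.to_countable _)
    (fun w _ => (Set.to_countable _).measurableSet) (pairwiseDisjoint_boxCounts lam V hV _)]
  refine tsum_congr fun w => ?_
  exact lintegral_countable _ (Set.to_countable _)

theorem setLIntegral_cubeRegion_eq_tsum (r : ℝ) (H : (Fin s → ℝ) → ℝ≥0∞) :
    ∫⁻ t in cubeRegion s r, H t
      = ∑' w : {w : Fin s → ℤ | ∀ a, |(w a : ℝ)| ≤ r}, ∫⁻ t in unitCube (w : Fin s → ℤ), H t := by
  rw [cubeRegion_eq_biUnion, lintegral_biUnion (Set.to_countable _)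
    (fun w _ => measurableSet_unitCube w) (pairwiseDisjoint_unitCube _)]

/-- Comparison of a sum over count vectors with an integral, from above. -/
theorem setLIntegral_boxRegion_le (lam : Fin q → ℝ≥0) (V : Fin s → Fin q → ℤ)
    (hV : LinearIndependent ℝ fun a => intVec (V a)) (r : ℝ) (k : ℕ)
    (hk : ∀ w : Fin s → ℤ, (∀ a, |(w a : ℝ)| ≤ r) → (boxCounts lam V w).encard = k)
    (f : (Fin q → ℕ) → ℝ≥0∞) (H : (Fin s → ℝ) → ℝ≥0∞)
    (hf : ∀ t ∈ cubeRegion s r, ∀ y ∈ boxCounts lam V (fun a => ⌊t a⌋),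
      f y * poissonLaw lam {y} ≤ H t) :
    ∫⁻ y in {y | countVec y - meanVec lam ∈ boxRegion V r}, f y ∂(poissonLaw lam)
      ≤ k * ∫⁻ t in cubeRegion s r, H t := by
  rw [setLIntegral_boxRegion_eq_tsum lam V hV, setLIntegral_cubeRegion_eq_tsum,
    ← ENNReal.tsum_mul_left]
  refine ENNReal.tsum_le_tsum fun w => ?_
  rw [← lintegral_const_mul' _ _ (ENNReal.natCast_ne_top k)]
  -- The cube has volume one, so the sum over the box is the integral of a constant, and the
  -- comparison becomes pointwise in `t`.
  calc _ = ∫⁻ t in unitCube (w : Fin s → ℤ), ∑' y : boxCounts lam V w,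
          f y * poissonLaw lam {(y : Fin q → ℕ)} := by
        rw [setLIntegral_const, volume_unitCube, mul_one]
    _ ≤ _ := by
        refine setLIntegral_mono' (measurableSet_unitCube _) fun t ht => ?_
        have hw : (fun a => ⌊t a⌋) = (w : Fin s → ℤ) := funext ht
        calc _ ≤ ∑' _ : boxCounts lam V w, H t := by
              refine ENNReal.tsum_le_tsum fun y => hf t (fun a => ?_) y (by rw [hw]; exact y.2)
              rw [ht a]; exact w.2 a
          _ = _ := by rw [ENNReal.tsum_set_const, hk w w.2]; rfl

/-- Comparison of a sum over count vectors with an integral, from below. -/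
theorem le_setLIntegral_boxRegion (lam : Fin q → ℝ≥0) (V : Fin s → Fin q → ℤ)
    (hV : LinearIndependent ℝ fun a => intVec (V a)) (r : ℝ) (k : ℕ)
    (hk : ∀ w : Fin s → ℤ, (∀ a, |(w a : ℝ)| ≤ r) → (boxCounts lam V w).encard = k)
    (f : (Fin q → ℕ) → ℝ≥0∞) (H : (Fin s → ℝ) → ℝ≥0∞)
    (hf : ∀ t ∈ cubeRegion s r, ∀ y ∈ boxCounts lam V (fun a => ⌊t a⌋),
      H t ≤ f y * poissonLaw lam {y}) :
    k * ∫⁻ t in cubeRegion s r, H t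
      ≤ ∫⁻ y in {y | countVec y - meanVec lam ∈ boxRegion V r}, f y ∂(poissonLaw lam) := by
  rw [setLIntegral_boxRegion_eq_tsum lam V hV, setLIntegral_cubeRegion_eq_tsum,
    ← ENNReal.tsum_mul_left]
  refine ENNReal.tsum_le_tsum fun w => ?_
  rw [← lintegral_const_mul' _ _ (ENNReal.natCast_ne_top k)]
  calc _ ≤ ∫⁻ t in unitCube (w : Fin s → ℤ), ∑' y : boxCounts lam V w,
          f y * poissonLaw lam {(y : Fin q → ℕ)} := by
        refine setLIntegral_mono' (measurableSet_unitCube _) fun t ht => ?_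
        have hw : (fun a => ⌊t a⌋) = (w : Fin s → ℤ) := funext ht
        calc _ = ∑' _ : boxCounts lam V w, H t := by
              rw [ENNReal.tsum_set_const, hk w w.2]; rfl
          _ ≤ _ := by
              refine ENNReal.tsum_le_tsum fun y => hf t (fun a => ?_) y (by rw [hw]; exact y.2)
              rw [ht a]; exact w.2 a
    _ = _ := by rw [setLIntegral_const, volume_unitCube, mul_one]

end Lattice

/-! ### Gaussian integrals in lattice coordinates. -/

section Gauss

variable {q s : ℕ}

theorem lintegral_comp_smul_pi (F : (Fin s → ℝ) → ℝ≥0∞) (c : ℝ) (hc : 0 < c) :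
    ∫⁻ t : Fin s → ℝ, F (c • t) = ENNReal.ofReal ((c ^ s)⁻¹) * ∫⁻ t, F t := by
  have h := Measure.map_addHaar_smul (volume : Measure (Fin s → ℝ)) hc.ne'
  have hm : MeasurableEmbedding fun t : Fin s → ℝ => c • t :=
    (MeasurableEquiv.smul₀ c hc.ne').measurableEmbedding
  rw [← hm.lintegral_map, h, lintegral_smul_measure, smul_eq_mul, Module.finrank_fin_fun,
    abs_of_pos (by positivity)]

theorem lintegral_gaussian_density (E : Submodule ℝ (EuclideanSpace ℝ (Fin q))) :
    ∫⁻ x : E, ENNReal.ofReal ((2 * Real.pi) ^ (-(Module.finrank ℝ E : ℝ) / 2)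
      * Real.exp (-‖x‖ ^ 2 / 2)) = 1 := by
  have h := GaussianFourier.integral_rexp_neg_mul_sq_norm (V := E) (b := 1 / 2) (by norm_num)
  have h1 : ∫ x : E, (2 * Real.pi) ^ (-(Module.finrank ℝ E : ℝ) / 2)
      * Real.exp (-‖x‖ ^ 2 / 2) = 1 := by
    rw [integral_const_mul]
    have e : ∀ x : E, -‖x‖ ^ 2 / 2 = -(1 / 2) * ‖x‖ ^ 2 := fun x => by ring
    simp_rw [e]
    rw [h, show Real.pi / (1 / 2) = 2 * Real.pi by ring, ← Real.rpow_add (by positivity)]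
    rw [show -(Module.finrank ℝ E : ℝ) / 2 + (Module.finrank ℝ E : ℝ) / 2 = 0 by ring,
      Real.rpow_zero]
  rw [← ofReal_integral_eq_lintegral_ofReal, h1, ENNReal.ofReal_one]
  -- Integrability comes for free: a non-integrable function would have integral 0 by convention,
  -- not 1.
  · by_contra hn
    rw [integral_undef hn] at h1
    exact zero_ne_one h1
  · exact Filter.Eventually.of_forall fun x => by positivity

/-- The Gaussian weight in coordinates. -/
noncomputable def gaussMass (Φ : (Fin s → ℝ) →ₗ[ℝ] EuclideanSpace ℝ (Fin q)) : ℝ≥0∞ :=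
  ∫⁻ t, ENNReal.ofReal (Real.exp (-‖Φ t‖ ^ 2 / 2))

/-- The standard normal distribution on the range of an injective linear map, in coordinates. -/
theorem lintegral_subspaceGaussian_range (Φ : (Fin s → ℝ) →ₗ[ℝ] EuclideanSpace ℝ (Fin q))
    (hΦ : Function.Injective Φ) :
    gaussMass Φ ≠ 0 ∧ gaussMass Φ ≠ ⊤ ∧ ∀ f : EuclideanSpace ℝ (Fin q) → ℝ≥0∞,
      ∫⁻ x, f x ∂(subspaceGaussian (LinearMap.range Φ))
        = (gaussMass Φ)⁻¹ * ∫⁻ t, ENNReal.ofReal (Real.exp (-‖Φ t‖ ^ 2 / 2)) * f (Φ t) := by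
  set E := LinearMap.range Φ with hE
  let e : (Fin s → ℝ) ≃L[ℝ] E := (LinearEquiv.ofInjective Φ hΦ).toContinuousLinearEquiv
  have hem : MeasurableEmbedding e := e.toHomeomorph.measurableEmbedding
  set κ : ℝ := (2 * Real.pi) ^ (-(Module.finrank ℝ E : ℝ) / 2) with hκ
  have hκ0 : 0 ≤ κ := by positivity
  have hmeas : Measurable fun x : E => ENNReal.ofReal (κ * Real.exp (-‖x‖ ^ 2 / 2)) := by
    fun_prop
  have : (Measure.map e (volume : Measure (Fin s → ℝ))).IsAddHaarMeasure :=
    e.isAddHaarMeasure_map volume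
  -- Uniqueness of Haar measure gives an unspecified Jacobian `c`; total mass one (`hone`) then
  -- determines `c * κ` as the inverse of `gaussMass Φ`.
  obtain ⟨c, hc⟩ : ∃ c : ℝ≥0, (volume : Measure E) = c • Measure.map e volume :=
    ⟨_, Measure.isAddLeftInvariant_eq_smul _ _⟩
  have hall : ∀ f : E → ℝ≥0∞,
      ∫⁻ x, ENNReal.ofReal (κ * Real.exp (-‖x‖ ^ 2 / 2)) * f x
        = (c * ENNReal.ofReal κ) *
          ∫⁻ t, ENNReal.ofReal (Real.exp (-‖Φ t‖ ^ 2 / 2)) * f (e t) := by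
    intro f
    rw [hc, lintegral_smul_measure, hem.lintegral_map, mul_assoc,
      ← lintegral_const_mul' _ _ ENNReal.ofReal_ne_top]
    simp_rw [ENNReal.ofReal_mul hκ0, mul_assoc]
    rfl
  have hone : (c * ENNReal.ofReal κ) * gaussMass Φ = 1 := by
    have := hall fun _ => 1
    simp only [mul_one] at this
    rw [gaussMass, ← this]
    exact lintegral_gaussian_density E
  have hinv : c * ENNReal.ofReal κ = (gaussMass Φ)⁻¹ := ENNReal.eq_inv_of_mul_eq_one_left hone
  refine ⟨fun h => by simp [h] at hone, fun h => ?_, fun f => ?_⟩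
  · rw [hinv, h] at hone; simp at hone
  · have hcl : MeasurableSet (E : Set (EuclideanSpace ℝ (Fin q))) :=
      (Submodule.closed_of_finiteDimensional E).measurableSet
    have hval : MeasurableEmbedding (Subtype.val : E → EuclideanSpace ℝ (Fin q)) :=
      MeasurableEmbedding.subtype_coe hcl
    rw [subspaceGaussian, hval.lintegral_map,
      OrthonormalBasis.addHaar_eq_volume,
      lintegral_withDensity_eq_lintegral_mul_non_measurable _ hmeas
        (Filter.Eventually.of_forall fun _ => ENNReal.ofReal_lt_top), ← hinv]
    exact hall fun x => f x

theorem lintegral_exp_neg_mul_sq (Φ : (Fin s → ℝ) →ₗ[ℝ] EuclideanSpace ℝ (Fin q)) (c : ℝ)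
    (hc : 0 < c) :
    ∫⁻ t, ENNReal.ofReal (Real.exp (-(c ^ 2 * ‖Φ t‖ ^ 2) / 2))
      = ENNReal.ofReal ((c ^ s)⁻¹) * gaussMass Φ := by
  rw [gaussMass, ← lintegral_comp_smul_pi _ c hc]
  simp_rw [map_smul, norm_smul, mul_pow, Real.norm_eq_abs, sq_abs]

/-- In the convergent case almost all of the Gaussian mass lies in a bounded region. -/
theorem exists_gaussMass_le (s : ℕ) (a : ℝ) (ha : 1 < a) :
    ∃ ε : ℝ, 0 < ε ∧ ∃ R : ℝ, 0 < R ∧ ∀ (q : ℕ) (Φ : (Fin s → ℝ) →ₗ[ℝ] EuclideanSpace ℝ (Fin q))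
      (T : Set (Fin s → ℝ)), MeasurableSet T → gaussMass Φ ≠ ⊤ → (∀ t, ‖Φ t‖ ≤ R → t ∈ T) →
      gaussMass Φ ≤ ENNReal.ofReal a *
        ∫⁻ t in T, ENNReal.ofReal (Real.exp (-((1 + ε) * ‖Φ t‖ ^ 2) / 2)) := by
  set b := (1 + a) / 2 with hb
  have hb1 : 1 < b := by rw [hb]; linarith
  have hba : b < a := by rw [hb]; linarith
  -- The factor `a` is shared: up to `b` pays for sharpening the Gaussian by `c`, and `a / b` pays
  -- for the tail outside `T`.
  obtain ⟨c, hc1, hcb⟩ : ∃ c : ℝ, 1 < c ∧ c ^ s < b := by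
    have h : Filter.Tendsto (fun c : ℝ => c ^ s) (nhdsWithin 1 (Set.Ioi 1)) (nhds (1 ^ s)) :=
      ((continuous_pow s).tendsto 1).mono_left nhdsWithin_le_nhds
    rw [one_pow] at h
    obtain ⟨c, h1, h2⟩ := ((h.eventually (gt_mem_nhds hb1)).and self_mem_nhdsWithin).exists
    exact ⟨c, h2, h1⟩
  have hc0 : 0 < c := by linarith
  have hd0 : 0 < 1 - b / a := by rw [sub_pos, div_lt_one (by linarith)]; exact hba
  obtain ⟨R, hR0, hR⟩ : ∃ R : ℝ, 0 < R ∧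
      Real.exp (-(c ^ 2 * R ^ 2) / 4) * (√2) ^ s ≤ 1 - b / a := by
    have h : Filter.Tendsto (fun R : ℝ => Real.exp (-(c ^ 2 * R ^ 2 / 4)) * (√2) ^ s) Filter.atTop
        (nhds (0 * (√2) ^ s)) := by
      refine Filter.Tendsto.mul_const _ (Real.tendsto_exp_neg_atTop_nhds_zero.comp ?_)
      exact ((Filter.tendsto_pow_atTop two_ne_zero).const_mul_atTop (by positivity)).atTop_div_const
        (by norm_num)
    rw [zero_mul] at h
    obtain ⟨R, h1, h2⟩ := ((h.eventually (gt_mem_nhds hd0)).and (Filter.eventually_gt_atTop 0)).exists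
    exact ⟨R, h2, by rw [neg_div]; exact h1.le⟩
  refine ⟨c ^ 2 - 1, by nlinarith, R, hR0, fun q Φ T hT hfin hTR => ?_⟩
  rw [add_sub_cancel]
  have hcont : Continuous fun t => ‖Φ t‖ := (LinearMap.continuous_of_finiteDimensional Φ).norm
  set J : (Fin s → ℝ) → ℝ≥0∞ := fun t => ENNReal.ofReal (Real.exp (-(c ^ 2 * ‖Φ t‖ ^ 2) / 2))
  have hJm : Measurable J := by
    have : Continuous fun t => Real.exp (-(c ^ 2 * ‖Φ t‖ ^ 2) / 2) := by fun_prop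
    exact this.measurable.ennreal_ofReal
  set I := ∫⁻ t in T, J t with hI
  set d := c / √2 with hd
  have hd00 : 0 < d := by positivity
  -- Outside `T` half of the exponent is bounded using `R < ‖Φ t‖`; the other half is a Gaussian of
  -- scale `d = c / √2`, whose mass costs the factor `√2 ^ s` allowed for in the choice of `R`.
  have hsplit : ∀ t, J t ≤ T.indicator J t + ENNReal.ofReal (Real.exp (-(c ^ 2 * R ^ 2) / 4)) *
      ENNReal.ofReal (Real.exp (-(d ^ 2 * ‖Φ t‖ ^ 2) / 2)) := by
    intro t
    by_cases ht : t ∈ T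
    · rw [Set.indicator_of_mem ht]; exact le_self_add
    · rw [Set.indicator_of_notMem ht, zero_add, ← ENNReal.ofReal_mul (by positivity),
        ← Real.exp_add]
      refine ENNReal.ofReal_le_ofReal (Real.exp_le_exp.2 ?_)
      have h1 : R < ‖Φ t‖ := by
        by_contra h; exact ht (hTR t (not_lt.1 h))
      have h2 : R ^ 2 ≤ ‖Φ t‖ ^ 2 := by gcongr
      have h3 : d ^ 2 = c ^ 2 / 2 := by rw [hd, div_pow, Real.sq_sqrt (by norm_num)]
      rw [h3]
      nlinarith [sq_nonneg c]
  have hle := lintegral_mono (μ := volume) hsplit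
  rw [lintegral_add_left (hJm.indicator hT), lintegral_indicator hT,
    lintegral_const_mul' _ _ ENNReal.ofReal_ne_top, lintegral_exp_neg_mul_sq Φ c hc0,
    lintegral_exp_neg_mul_sq Φ d hd00] at hle
  have hIfin : I ≠ ⊤ := by
    have : I ≤ ENNReal.ofReal ((c ^ s)⁻¹) * gaussMass Φ := by
      rw [← lintegral_exp_neg_mul_sq Φ c hc0]; exact setLIntegral_le_lintegral _ _
    exact ne_top_of_le_ne_top (ENNReal.mul_ne_top ENNReal.ofReal_ne_top hfin) this
  lift gaussMass Φ to ℝ≥0 using hfin with z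
  change _ ≤ I + _ at hle
  lift I to ℝ≥0 using hIfin with i
  rw [← ENNReal.ofReal_coe_nnreal (p := z), ← ENNReal.ofReal_coe_nnreal (p := i)] at hle ⊢
  rw [← ENNReal.ofReal_mul (by positivity), ← ENNReal.ofReal_mul (by positivity),
    ← ENNReal.ofReal_mul (by positivity), ← ENNReal.ofReal_add (by positivity) (by positivity),
    ENNReal.ofReal_le_ofReal_iff (by positivity)] at hle
  rw [← ENNReal.ofReal_mul (by positivity)]
  refine ENNReal.ofReal_le_ofReal ?_
  have hds : (d ^ s)⁻¹ = (√2) ^ s * (c ^ s)⁻¹ := by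
    rw [hd, div_pow, inv_div, div_eq_mul_inv]
  rw [hds] at hle
  have hz : (0 : ℝ) ≤ z := z.2
  have hi : (0 : ℝ) ≤ i := i.2
  have hcs : 0 < c ^ s := by positivity
  have h5 : (z : ℝ) ≤ c ^ s * i + (1 - b / a) * z := by
    have h6 : (c ^ s)⁻¹ * (z : ℝ) ≤ i + (1 - b / a) * ((c ^ s)⁻¹ * z) := by
      refine hle.trans ?_
      have : 0 ≤ (c ^ s)⁻¹ * (z : ℝ) := by positivity
      nlinarith
    have h7 := mul_le_mul_of_nonneg_left h6 hcs.le
    calc (z : ℝ) = c ^ s * ((c ^ s)⁻¹ * z) := by field_simp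
      _ ≤ _ := h7
      _ = _ := by field_simp
  have h8 : b / a * z ≤ b * i := by nlinarith
  have h9 : (z : ℝ) / a ≤ i := by
    have : b * ((z : ℝ) / a) ≤ b * i := by
      calc _ = b / a * z := by ring
        _ ≤ _ := h8
    exact le_of_mul_le_mul_left this (by linarith)
  rw [div_le_iff₀ (by linarith)] at h9
  linarith

/-- Gaussian integrals of a radially increasing weight grow when the variance grows, with a gain
that beats any loss of mass. -/
theorem exists_setLIntegral_exp_le (s : ℕ) (θ : ℝ) (hθ : 1 < θ) (a : ℝ) (ha : 1 < a) :
    ∃ ε : ℝ, 0 < ε ∧ ε < 1 ∧ ∃ R : ℝ, 0 < R ∧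
      ∀ (q : ℕ) (Φ : (Fin s → ℝ) →ₗ[ℝ] EuclideanSpace ℝ (Fin q))
      (g : ℝ → ℝ) (_ : MonotoneOn g (Set.Ici 0)) (_ : ContinuousOn g (Set.Ici 0))
      (T : Set (Fin s → ℝ)), MeasurableSet T → (∀ t, ‖Φ t‖ ≤ R → t ∈ T) →
      ∫⁻ t in T, ENNReal.ofReal (Real.exp (g (‖Φ t‖ ^ 2) - (1 - ε) * ‖Φ t‖ ^ 2 / 2))
        ≤ ENNReal.ofReal (a * (θ ^ s)⁻¹) *
        ∫⁻ t in T, ENNReal.ofReal (Real.exp (g (‖Φ t‖ ^ 2) - (θ ^ 2)⁻¹ * ‖Φ t‖ ^ 2 / 2)) := by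
  have hθ0 : 0 < θ := by linarith
  have hθi : θ⁻¹ < 1 := inv_lt_one_of_one_lt₀ hθ
  set b := (1 + a) / 2 with hb
  have hb1 : 1 < b := by rw [hb]; linarith
  have hba : b < a := by rw [hb]; linarith
  obtain ⟨c, hc1, hcθ, hcb⟩ : ∃ c : ℝ, c < 1 ∧ θ⁻¹ < c ∧ (c ^ s)⁻¹ < b := by
    have h : Filter.Tendsto (fun c : ℝ => (c ^ s)⁻¹) (nhdsWithin 1 (Set.Iio 1))
        (nhds ((1 ^ s)⁻¹)) :=
      (((continuous_pow s).tendsto 1).inv₀ (by simp)).mono_left nhdsWithin_le_nhds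
    rw [one_pow, inv_one] at h
    obtain ⟨c, ⟨h1, h3⟩, h2⟩ := (((h.eventually (gt_mem_nhds hb1)).and
      (nhdsWithin_le_nhds (lt_mem_nhds hθi))).and self_mem_nhdsWithin).exists
    exact ⟨c, h2, h3, h1⟩
  have hc0 : 0 < c := (inv_pos.2 hθ0).trans hcθ
  have hτ : 1 < θ * c := by
    rwa [inv_lt_iff_one_lt_mul₀ hθ0, mul_comm] at hcθ
  have hκ : 0 < c ^ 2 - (θ ^ 2)⁻¹ := by
    have : (θ⁻¹) ^ 2 < c ^ 2 := by gcongr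
    rw [inv_pow] at this; linarith
  obtain ⟨r, hr0, hr⟩ : ∃ r : ℝ, 0 < r ∧
      Real.exp (-((c ^ 2 - (θ ^ 2)⁻¹) * r ^ 2 / 2)) ≤ (a - b) * (θ ^ s)⁻¹ := by
    have h : Filter.Tendsto (fun r : ℝ => Real.exp (-((c ^ 2 - (θ ^ 2)⁻¹) * r ^ 2 / 2)))
        Filter.atTop (nhds 0) := by
      refine Real.tendsto_exp_neg_atTop_nhds_zero.comp ?_
      exact ((Filter.tendsto_pow_atTop two_ne_zero).const_mul_atTop hκ).atTop_div_const (by norm_num)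
    have hpos : 0 < (a - b) * (θ ^ s)⁻¹ := mul_pos (by linarith) (by positivity)
    obtain ⟨r, h1, h2⟩ := ((h.eventually (gt_mem_nhds hpos)).and
      (Filter.eventually_gt_atTop 0)).exists
    exact ⟨r, h2, h1.le⟩
  -- The dilation by `θ * c` sends the ball of radius `r` onto the ball of radius `θ * c * r`, which
  -- must still lie in `T`; `T` itself need not be stable under dilation.
  refine ⟨1 - c ^ 2, by nlinarith, by nlinarith, θ * c * r, by positivity,
    fun q Φ g hgm hgc T hT hTR => ?_⟩
  rw [sub_sub_cancel]
  have hcont : Continuous fun t => ‖Φ t‖ := (LinearMap.continuous_of_finiteDimensional Φ).norm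
  have hgcont : Continuous fun t => g (‖Φ t‖ ^ 2) :=
    hgc.comp_continuous (hcont.pow 2) fun t => Set.mem_Ici.2 (sq_nonneg _)
  set F₁ : (Fin s → ℝ) → ℝ≥0∞ := fun t =>
    ENNReal.ofReal (Real.exp (g (‖Φ t‖ ^ 2) - c ^ 2 * ‖Φ t‖ ^ 2 / 2)) with hF₁
  set F₂ : (Fin s → ℝ) → ℝ≥0∞ := fun t =>
    ENNReal.ofReal (Real.exp (g (‖Φ t‖ ^ 2) - (θ ^ 2)⁻¹ * ‖Φ t‖ ^ 2 / 2)) with hF₂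
  have hF₁m : Measurable F₁ := by
    have : Continuous fun t => Real.exp (g (‖Φ t‖ ^ 2) - c ^ 2 * ‖Φ t‖ ^ 2 / 2) :=
      Real.continuous_exp.comp (hgcont.sub (by fun_prop))
    exact this.measurable.ennreal_ofReal
  set B : ℝ → Set (Fin s → ℝ) := fun r => {t | ‖Φ t‖ ≤ r} with hB
  have hBm : ∀ r, MeasurableSet (B r) := fun r => (isClosed_le hcont continuous_const).measurableSet
  -- Beyond radius `r` the weight `g` plays no role: the exponents differ by at least `(c ^ 2 - (θ ^
  -- 2)⁻¹) * r ^ 2 / 2`.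
  have hsplit : ∀ t, T.indicator F₁ t ≤ (B r).indicator F₁ t
      + ENNReal.ofReal ((a - b) * (θ ^ s)⁻¹) * T.indicator F₂ t := by
    intro t
    by_cases htB : t ∈ B r
    · rw [Set.indicator_of_mem htB]
      exact (Set.indicator_le_self _ _ _).trans le_self_add
    · rw [Set.indicator_of_notMem htB, zero_add]
      by_cases ht : t ∈ T
      · rw [Set.indicator_of_mem ht, Set.indicator_of_mem ht]
        have h1 : r ^ 2 ≤ ‖Φ t‖ ^ 2 := by
          have : r < ‖Φ t‖ := not_le.1 htB
          gcongr
        calc F₁ t ≤ ENNReal.ofReal (Real.exp (-((c ^ 2 - (θ ^ 2)⁻¹) * r ^ 2 / 2)) *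
              Real.exp (g (‖Φ t‖ ^ 2) - (θ ^ 2)⁻¹ * ‖Φ t‖ ^ 2 / 2)) := by
              rw [← Real.exp_add]
              refine ENNReal.ofReal_le_ofReal (Real.exp_le_exp.2 ?_)
              nlinarith
          _ = ENNReal.ofReal (Real.exp (-((c ^ 2 - (θ ^ 2)⁻¹) * r ^ 2 / 2))) * F₂ t :=
              ENNReal.ofReal_mul (by positivity)
          _ ≤ _ := by gcongr
      · rw [Set.indicator_of_notMem ht]; exact zero_le
  -- The dilation by `θ * c > 1` matches the two quadratic exponents exactly, can only increase `g`,
  -- and has Jacobian factor `(θ * c) ^ (-s) ≤ b * θ ^ (-s)`.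
  have hscale : ∫⁻ t, (B r).indicator F₁ t
      ≤ ENNReal.ofReal (((θ * c) ^ s)⁻¹) * ∫⁻ t, (B (θ * c * r)).indicator F₂ t := by
    rw [← lintegral_comp_smul_pi _ (θ * c) (by linarith)]
    refine lintegral_mono fun t => ?_
    by_cases htB : t ∈ B r
    · have hn : ‖Φ ((θ * c) • t)‖ = θ * c * ‖Φ t‖ := by
        rw [map_smul, norm_smul, Real.norm_eq_abs, abs_of_pos (by linarith)]
      have htB' : (θ * c) • t ∈ B (θ * c * r) := by
        change ‖Φ ((θ * c) • t)‖ ≤ _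
        rw [hn]
        exact mul_le_mul_of_nonneg_left htB (by linarith)
      change (B r).indicator F₁ t ≤ (B (θ * c * r)).indicator F₂ ((θ * c) • t)
      rw [Set.indicator_of_mem htB, Set.indicator_of_mem htB']
      simp only [hF₁, hF₂]
      rw [hn]
      refine ENNReal.ofReal_le_ofReal (Real.exp_le_exp.2 ?_)
      have h1 : g (‖Φ t‖ ^ 2) ≤ g ((θ * c * ‖Φ t‖) ^ 2) := by
        refine hgm (Set.mem_Ici.2 (sq_nonneg _)) (Set.mem_Ici.2 (sq_nonneg _)) ?_
        gcongr
        nlinarith [norm_nonneg (Φ t)]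
      have h2 : (θ ^ 2)⁻¹ * (θ * c * ‖Φ t‖) ^ 2 = c ^ 2 * ‖Φ t‖ ^ 2 := by
        field_simp
      rw [h2]; linarith
    · rw [Set.indicator_of_notMem htB]; exact zero_le
  calc ∫⁻ t in T, F₁ t = ∫⁻ t, T.indicator F₁ t := (lintegral_indicator hT _).symm
    _ ≤ ∫⁻ t, ((B r).indicator F₁ t
          + ENNReal.ofReal ((a - b) * (θ ^ s)⁻¹) * T.indicator F₂ t) := lintegral_mono hsplit
    _ = (∫⁻ t, (B r).indicator F₁ t)
          + ENNReal.ofReal ((a - b) * (θ ^ s)⁻¹) * ∫⁻ t in T, F₂ t := by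
        rw [lintegral_add_left (hF₁m.indicator (hBm r)),
          lintegral_const_mul' _ _ ENNReal.ofReal_ne_top, lintegral_indicator hT]
    _ ≤ ENNReal.ofReal (b * (θ ^ s)⁻¹) * (∫⁻ t in T, F₂ t)
          + ENNReal.ofReal ((a - b) * (θ ^ s)⁻¹) * ∫⁻ t in T, F₂ t := by
        gcongr
        refine hscale.trans ?_
        rw [lintegral_indicator (hBm _)]
        refine mul_le_mul' (ENNReal.ofReal_le_ofReal ?_) (lintegral_mono_set fun t ht => hTR t ht)
        rw [mul_pow, mul_inv, mul_comm]
        gcongr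
    _ = _ := by
        rw [← add_mul, ← ENNReal.ofReal_add (by positivity)
          (mul_nonneg (by linarith) (by positivity))]
        congr 2; ring

end Gauss

/-! ### Variation of the weight within a box. -/

/-- Moving the radius by `ρ` moves its square by up to `ρ * (2 + b ^ 2)`, which is unbounded.
Uniform continuity, chained in steps of length `d / 2`, makes `g` grow at most linearly, so the loss
is a small multiple of `1 + b ^ 2`, which a Gaussian exponent can absorb. -/
theorem exists_modulus_sq (g : ℝ → ℝ) (hu : UniformContinuousOn g (Set.Ici 0))
    (hm : MonotoneOn g (Set.Ici 0)) (ε : ℝ) (hε : 0 < ε) :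
    ∃ ρ : ℝ, 0 < ρ ∧ ∀ a b : ℝ, 0 ≤ a → 0 ≤ b → |a - b| ≤ ρ →
      g (a ^ 2) ≤ g (b ^ 2) + ε + ε * b ^ 2 := by
  obtain ⟨d, hd, h⟩ := Metric.uniformContinuousOn_iff.1 hu (ε / 4) (by positivity)
  have step : ∀ n : ℕ, ∀ x : ℝ, 0 ≤ x → g (x + n * (d / 2)) ≤ g x + n * (ε / 4) := by
    intro n x hx
    induction n with
    | zero => simp
    | succ n ih =>
      have h0 : 0 ≤ x + n * (d / 2) := by positivity
      have h1 := h (x + (n + 1 : ℕ) * (d / 2)) (Set.mem_Ici.2 (by positivity))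
        (x + n * (d / 2)) (Set.mem_Ici.2 h0) (by
          rw [Real.dist_eq, show x + (n + 1 : ℕ) * (d / 2) - (x + n * (d / 2)) = d / 2 by
            push_cast; ring, abs_of_pos (by positivity)]
          linarith)
      rw [Real.dist_eq] at h1
      have h2 := (abs_lt.1 h1).2
      push_cast at h2 ⊢
      linarith
  have growth : ∀ x y : ℝ, 0 ≤ x → 0 ≤ y → g (x + y) ≤ g x + (ε / 4) * (y / (d / 2) + 1) := by
    intro x y hx hy
    have hy' : 0 ≤ y / (d / 2) := by positivity
    have h1 : y ≤ ⌈y / (d / 2)⌉₊ * (d / 2) := by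
      rw [← div_le_iff₀ (by positivity)]; exact Nat.le_ceil _
    have h2 : (⌈y / (d / 2)⌉₊ : ℝ) ≤ y / (d / 2) + 1 := (Nat.ceil_lt_add_one hy').le
    calc g (x + y) ≤ g (x + ⌈y / (d / 2)⌉₊ * (d / 2)) :=
          hm (Set.mem_Ici.2 (by positivity)) (Set.mem_Ici.2 (by positivity)) (by linarith)
      _ ≤ g x + ⌈y / (d / 2)⌉₊ * (ε / 4) := step _ x hx
      _ ≤ _ := by nlinarith
  refine ⟨min 1 (d / 2), by positivity, fun a b ha hb hab => ?_⟩
  set ρ := min 1 (d / 2) with hρ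
  have hρ0 : 0 < ρ := by positivity
  have hρ1 : ρ ≤ 1 := min_le_left _ _
  have hρd : ρ ≤ d / 2 := min_le_right _ _
  have hab' : a ≤ b + ρ := by linarith [(abs_le.1 hab).2]
  have h1 : a ^ 2 ≤ b ^ 2 + ρ * (2 + b ^ 2) := by
    have : a ^ 2 ≤ (b + ρ) ^ 2 := by gcongr
    nlinarith [mul_nonneg hρ0.le (sq_nonneg (b - 1)), mul_nonneg hρ0.le (sub_nonneg.2 hρ1)]
  have h2 : ρ * (2 + b ^ 2) / (d / 2) ≤ 2 + b ^ 2 := by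
    rw [div_le_iff₀ (by positivity)]
    nlinarith [sq_nonneg b]
  calc g (a ^ 2) ≤ g (b ^ 2 + ρ * (2 + b ^ 2)) :=
        hm (Set.mem_Ici.2 (by positivity)) (Set.mem_Ici.2 (by positivity)) h1
    _ ≤ g (b ^ 2) + (ε / 4) * (ρ * (2 + b ^ 2) / (d / 2) + 1) :=
        growth _ _ (by positivity) (by positivity)
    _ ≤ g (b ^ 2) + (ε / 4) * (2 + b ^ 2 + 1) := by gcongr
    _ ≤ _ := by nlinarith [sq_nonneg b]

/-! ### Size of `D⁻¹` in terms of `ν`. -/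

section Scaling

variable {q : ℕ}

theorem norm_invD_sq (lam : Fin q → ℝ≥0) (x : EuclideanSpace ℝ (Fin q)) :
    ‖invD lam x‖ ^ 2 = ∑ i, x i ^ 2 / lam i := by
  rw [EuclideanSpace.norm_sq_eq]
  refine Finset.sum_congr rfl fun i _ => ?_
  simp [invD, div_pow]

theorem norm_invD_le (lam : Fin q → ℝ≥0) (m : ℝ) (hm : 0 < m) (h : ∀ i, m ≤ lam i)
    (x : EuclideanSpace ℝ (Fin q)) : ‖invD lam x‖ ≤ ‖x‖ / √m := by
  refine le_of_sq_le_sq ?_ (by positivity)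
  rw [norm_invD_sq, div_pow, Real.sq_sqrt hm.le, EuclideanSpace.norm_sq_eq, Finset.sum_div]
  refine Finset.sum_le_sum fun i _ => ?_
  rw [Real.norm_eq_abs, sq_abs]
  have := h i
  gcongr

theorem norm_le_invD (lam : Fin q → ℝ≥0) (h : ∀ i, 0 < lam i)
    (x : EuclideanSpace ℝ (Fin q)) : ‖x‖ ≤ √(totalMean lam) * ‖invD lam x‖ := by
  have h0 : 0 ≤ totalMean lam := Finset.sum_nonneg fun i _ => (lam i).2
  refine le_of_sq_le_sq ?_ (by positivity)
  rw [mul_pow, norm_invD_sq, Real.sq_sqrt h0, EuclideanSpace.norm_sq_eq, Finset.mul_sum]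
  refine Finset.sum_le_sum fun i _ => ?_
  rw [Real.norm_eq_abs, sq_abs]
  have h1 : (0 : ℝ) < lam i := h i
  have h2 : (lam i : ℝ) ≤ totalMean lam :=
    Finset.single_le_sum (f := fun i => (lam i : ℝ)) (fun i _ => (lam i).2) (Finset.mem_univ i)
  calc x i ^ 2 = lam i * (x i ^ 2 / lam i) := by field_simp
    _ ≤ _ := by gcongr

theorem invD_injective (lam : Fin q → ℝ≥0) (h : ∀ i, 0 < lam i) :
    Function.Injective (invD lam) := by
  refine (injective_iff_map_eq_zero _).2 fun x hx => ?_
  have := norm_le_invD lam h x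
  rw [hx, norm_zero, mul_zero] at this
  exact norm_le_zero_iff.1 this

end Scaling

/-! ### Elementary inequalities for the final bookkeeping. -/

/-- Transfers the upper local limit bound from a count vector (`a` is the norm of `stdVec`) to any
point of its cube (`b` is the norm of `Φ t`), collecting all errors into `3 * ε` and `ε'`. Its
counterpart `le_exponent` does this for the lower bound. -/
theorem exponent_le {ε ε' a b ga gb : ℝ} (hε : 0 < ε) (hε1 : ε ≤ 1) (hε' : 4 * ε ≤ ε')
    (h : b ^ 2 ≤ a ^ 2 + ε + ε * a ^ 2) (hg : ga ≤ gb + ε + ε * b ^ 2) :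
    ga + (ε - (1 - ε) * a ^ 2 / 2) ≤ 3 * ε + (gb - (1 - ε') * b ^ 2 / 2) := by
  have ha := sq_nonneg a
  have hb := sq_nonneg b
  have key : (1 - 2 * ε) * b ^ 2 - (1 - ε) * a ^ 2 ≤ 2 * ε := by
    rcases le_total 0 (1 - 2 * ε) with h1 | h1
    · nlinarith [mul_le_mul_of_nonneg_left h h1, mul_nonneg (mul_nonneg hε.le hε.le) ha]
    · nlinarith [mul_nonneg (sub_nonneg.2 hε1) ha, mul_nonneg (neg_nonneg.2 h1) hb]
  have h4 := mul_le_mul_of_nonneg_right hε' hb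
  linarith

theorem le_exponent {ε ε' a b : ℝ} (hε : 0 < ε) (hε1 : ε ≤ 1) (hε' : 4 * ε ≤ ε')
    (h : a ^ 2 ≤ b ^ 2 + ε + ε * b ^ 2) :
    -(3 * ε) + -((1 + ε') * b ^ 2) / 2 ≤ -ε - (1 + ε) * a ^ 2 / 2 := by
  have hb := sq_nonneg b
  have h1 : (1 + ε) * a ^ 2 ≤ (1 + ε) * (b ^ 2 + ε + ε * b ^ 2) := by gcongr
  have h4 := mul_le_mul_of_nonneg_right hε' hb
  nlinarith [mul_nonneg (mul_nonneg hε.le (sub_nonneg.2 hε1)) hb,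
    mul_nonneg hε.le (sub_nonneg.2 hε1), mul_nonneg hε.le hb]

theorem inv_mul_le_mul_inv {P Z c d : ℝ≥0∞} (hP : P ≠ 0) (hP' : P ≠ ⊤) (hZ : Z ≠ 0) (hZ' : Z ≠ ⊤)
    (h : Z * c ≤ d * P) : P⁻¹ * c ≤ d * Z⁻¹ := by
  calc P⁻¹ * c = P⁻¹ * Z⁻¹ * (Z * c) := by
        rw [mul_assoc, ← mul_assoc Z⁻¹, ENNReal.inv_mul_cancel hZ hZ', one_mul]
    _ ≤ P⁻¹ * Z⁻¹ * (d * P) := by gcongr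
    _ = (P⁻¹ * P) * (d * Z⁻¹) := by ring
    _ = _ := by rw [ENNReal.inv_mul_cancel hP hP', one_mul]

instance isProbabilityMeasure_poissonLaw {q : ℕ} (lam : Fin q → ℝ≥0) :
    IsProbabilityMeasure (poissonLaw lam) :=
  inferInstanceAs (IsProbabilityMeasure (Measure.pi fun i => poissonMeasure (lam i)))

/-! ### Both sides of (ii) in lattice coordinates. -/

section Main

variable {q s : ℕ}

/-- The map `t ↦ D⁻¹ ∑ t_a V_a`. -/
noncomputable def stdLatticeMap (lam : Fin q → ℝ≥0) (V : Fin s → Fin q → ℤ) :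
    (Fin s → ℝ) →ₗ[ℝ] EuclideanSpace ℝ (Fin q) :=
  invD lam ∘ₗ latticeMap V

theorem range_stdLatticeMap (lam : Fin q → ℝ≥0) (V : Fin s → Fin q → ℤ) :
    LinearMap.range (stdLatticeMap lam V) = (latticeSpan V).map (invD lam) := by
  rw [stdLatticeMap, LinearMap.range_comp, range_latticeMap]

theorem invD_image_boxRegion (lam : Fin q → ℝ≥0) (V : Fin s → Fin q → ℤ) (r : ℝ) :
    invD lam '' boxRegion V r = stdLatticeMap lam V '' cubeRegion s r := by
  rw [boxRegion_eq_image, Set.image_image]; rfl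

theorem boxRegion_subset_latticeSpan (V : Fin s → Fin q → ℤ) (r : ℝ) :
    boxRegion V r ⊆ (latticeSpan V : Set (EuclideanSpace ℝ (Fin q))) := by
  rw [boxRegion_eq_image, ← range_latticeMap]
  exact Set.image_subset_range _ _

/-- The normal integral over the shrunken region, in lattice coordinates. -/
theorem le_setLIntegral_limitNormal (lam : Fin q → ℝ≥0) (V : Fin s → Fin q → ℤ)
    (hΦ : Function.Injective (stdLatticeMap lam V)) (g : ℝ → ℝ) (θ : ℝ) (hθ : 0 < θ) (r : ℝ) :
    (gaussMass (stdLatticeMap lam V))⁻¹ * (ENNReal.ofReal ((θ ^ s)⁻¹) *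
      ∫⁻ t in cubeRegion s r, ENNReal.ofReal (Real.exp (g (‖stdLatticeMap lam V t‖ ^ 2)
        - (θ ^ 2)⁻¹ * ‖stdLatticeMap lam V t‖ ^ 2 / 2)))
    ≤ ∫⁻ x in {x | θ • x ∈ invD lam '' boxRegion V r},
        ENNReal.ofReal (Real.exp (g (θ ^ 2 * ‖x‖ ^ 2))) ∂(limitNormal lam (latticeSpan V)) := by
  set Φ := stdLatticeMap lam V with hΦ'
  -- This inequality holds for arbitrary sets, so measurability of the dilated region is not needed.
  refine le_trans ?_ (lintegral_indicator_le _ _)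
  rw [limitNormal, ← range_stdLatticeMap, (lintegral_subspaceGaussian_range Φ hΦ).2.2]
  refine mul_le_mul' le_rfl ?_
  rw [← lintegral_indicator (measurableSet_cubeRegion r), ← lintegral_comp_smul_pi _ θ hθ]
  refine lintegral_mono fun t => ?_
  by_cases ht : θ • t ∈ cubeRegion s r
  · have hx : Φ t ∈ {x | θ • x ∈ invD lam '' boxRegion V r} := by
      change θ • Φ t ∈ invD lam '' boxRegion V r
      rw [← map_smul, invD_image_boxRegion]
      exact Set.mem_image_of_mem _ ht
    have hn : ‖Φ (θ • t)‖ ^ 2 = θ ^ 2 * ‖Φ t‖ ^ 2 := by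
      rw [map_smul, norm_smul, mul_pow, Real.norm_eq_abs, sq_abs]
    rw [Set.indicator_of_mem hx]
    simp only [Set.indicator_of_mem ht]
    rw [hn, ← ENNReal.ofReal_mul (by positivity), ← Real.exp_add]
    refine ENNReal.ofReal_le_ofReal (Real.exp_le_exp.2 (le_of_eq ?_))
    field_simp
    ring
  · simp only [Set.indicator_of_notMem ht]; exact zero_le

theorem setLIntegral_condLaw_le (lam : Fin q → ℝ≥0) (L : Submodule ℝ (EuclideanSpace ℝ (Fin q)))
    (S : Set (Fin q → ℕ)) (f : (Fin q → ℕ) → ℝ≥0∞) :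
    ∫⁻ y in S, f y ∂(condLaw lam L)
      ≤ (poissonLaw lam (linearEvent lam L))⁻¹ * ∫⁻ y in S, f y ∂(poissonLaw lam) := by
  rw [condLaw, ProbabilityTheory.cond, Measure.restrict_smul, lintegral_smul_measure, smul_eq_mul]
  refine mul_le_mul' le_rfl (lintegral_mono' ?_ le_rfl)
  exact Measure.restrict_mono le_rfl Measure.restrict_le_self

end Main

/-! ### Assembly of the estimates. -/

theorem norm_le_of_mem_cubeRegion {s : ℕ} {r : ℝ} (hr : 0 ≤ r) {t : Fin s → ℝ}
    (ht : t ∈ cubeRegion s r) : ‖t‖ ≤ r + 1 := by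
  refine (pi_norm_le_iff_of_nonneg (by linarith)).2 fun a => ?_
  have h1 := abs_le.1 (ht a)
  have h2 := Int.floor_le (t a)
  have h3 := Int.lt_floor_add_one (t a)
  rw [Real.norm_eq_abs, abs_le]
  constructor <;> linarith

theorem mem_cubeRegion_of_norm_le {s : ℕ} {r : ℝ} {t : Fin s → ℝ}
    (ht : ‖t‖ + 1 ≤ r) : t ∈ cubeRegion s r := by
  intro a
  have h1 := abs_le.1 ((Real.norm_eq_abs _).symm.le.trans (norm_le_pi_norm t a))
  have h2 := Int.floor_le (t a)
  have h3 := Int.lt_floor_add_one (t a)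
  rw [abs_le]
  constructor <;> linarith

theorem norm_sub_le_one_of_floor_eq {s : ℕ} {t u : Fin s → ℝ} (h : ∀ a, ⌊t a⌋ = ⌊u a⌋) :
    ‖t - u‖ ≤ 1 :=
  (pi_norm_le_iff_of_nonneg zero_le_one).2 fun a =>
    (Int.abs_sub_lt_one_of_floor_eq_floor (h a)).le

/-- The comparison of the conditional law with the normal distribution for one vector of means,
given a local limit bound on each box. -/
theorem setLIntegral_condLaw_le_limitNormal {q s : ℕ} (lam : Fin q → ℝ≥0)
    (V : Fin s → Fin q → ℤ) (hV : LinearIndependent ℝ fun a => intVec (V a))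
    (hD : Function.Injective (invD lam)) (g : ℝ → ℝ) (θ a ε εA εB r C : ℝ)
    (ha : 1 < a) (haθ : a ^ 3 ≤ θ) (hεa : Real.exp (6 * ε) ≤ a) (hC : 0 < C) (k : ℕ) (hk0 : 0 < k)
    (hk : ∀ w : Fin s → ℤ, (∀ a, |(w a : ℝ)| ≤ r) → (boxCounts lam V w).encard = k)
    (hup : ∀ t ∈ cubeRegion s r, ∀ y ∈ boxCounts lam V (fun a => ⌊t a⌋),
      ENNReal.ofReal (Real.exp (g (‖stdVec lam y‖ ^ 2))) * poissonLaw lam {y}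
        ≤ ENNReal.ofReal (C * Real.exp (3 * ε)) * ENNReal.ofReal (Real.exp
          (g (‖stdLatticeMap lam V t‖ ^ 2) - (1 - εA) * ‖stdLatticeMap lam V t‖ ^ 2 / 2)))
    (hlow : ∀ t ∈ cubeRegion s r, ∀ y ∈ boxCounts lam V (fun a => ⌊t a⌋),
      ENNReal.ofReal (C * Real.exp (-(3 * ε))) * ENNReal.ofReal (Real.exp
          (-((1 + εB) * ‖stdLatticeMap lam V t‖ ^ 2) / 2)) ≤ poissonLaw lam {y})
    (hA : ∫⁻ t in cubeRegion s r, ENNReal.ofReal (Real.exp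
          (g (‖stdLatticeMap lam V t‖ ^ 2) - (1 - εA) * ‖stdLatticeMap lam V t‖ ^ 2 / 2))
        ≤ ENNReal.ofReal (a * (θ ^ s)⁻¹) * ∫⁻ t in cubeRegion s r, ENNReal.ofReal (Real.exp
          (g (‖stdLatticeMap lam V t‖ ^ 2) - (θ ^ 2)⁻¹ * ‖stdLatticeMap lam V t‖ ^ 2 / 2)))
    (hB : gaussMass (stdLatticeMap lam V) ≤ ENNReal.ofReal a * ∫⁻ t in cubeRegion s r,
        ENNReal.ofReal (Real.exp (-((1 + εB) * ‖stdLatticeMap lam V t‖ ^ 2) / 2))) :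
    0 < poissonLaw lam (linearEvent lam (latticeSpan V)) ∧
    ∫⁻ y in {y | stdVec lam y ∈ invD lam '' boxRegion V r},
        ENNReal.ofReal (Real.exp (g (‖stdVec lam y‖ ^ 2))) ∂(condLaw lam (latticeSpan V))
      ≤ ENNReal.ofReal θ * ∫⁻ x in {x | θ • x ∈ invD lam '' boxRegion V r},
          ENNReal.ofReal (Real.exp (g (θ ^ 2 * ‖x‖ ^ 2))) ∂(limitNormal lam (latticeSpan V)) := by
  have ha0 : 0 < a := by linarith
  have hθ0 : 0 < θ := lt_of_lt_of_le (by positivity) haθ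
  have hset : {y | stdVec lam y ∈ invD lam '' boxRegion V r}
      ⊆ {y | countVec y - meanVec lam ∈ boxRegion V r} := by
    rintro y ⟨x, hx, e⟩
    rw [Set.mem_ofPred_eq, ← hD e]
    exact hx
  have hΦ : Function.Injective (stdLatticeMap lam V) := hD.comp (latticeMap_injective V hV)
  set Φ := stdLatticeMap lam V with hΦ'
  obtain ⟨hZ0, hZt, -⟩ := lintegral_subspaceGaussian_range Φ hΦ
  set P := poissonLaw lam (linearEvent lam (latticeSpan V)) with hP
  set Z := gaussMass Φ with hZ
  set I := ∫⁻ t in cubeRegion s r,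
        ENNReal.ofReal (Real.exp (-((1 + εB) * ‖Φ t‖ ^ 2) / 2)) with hI
  set A := ∫⁻ t in cubeRegion s r, ENNReal.ofReal (Real.exp
          (g (‖Φ t‖ ^ 2) - (1 - εA) * ‖Φ t‖ ^ 2 / 2)) with hA'
  set B := ∫⁻ t in cubeRegion s r, ENNReal.ofReal (Real.exp
          (g (‖Φ t‖ ^ 2) - (θ ^ 2)⁻¹ * ‖Φ t‖ ^ 2 / 2)) with hB'
  have hPt : P ≠ ⊤ := measure_ne_top _ _
  have hPle : k * (ENNReal.ofReal (C * Real.exp (-(3 * ε))) * I) ≤ P := by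
    have h := le_setLIntegral_boxRegion lam V hV r k hk (fun _ => 1) _
      (fun t ht y hy => by rw [one_mul]; exact hlow t ht y hy)
    rw [lintegral_const_mul' _ _ ENNReal.ofReal_ne_top, setLIntegral_one] at h
    exact h.trans (measure_mono fun y hy => boxRegion_subset_latticeSpan V r hy)
  have hI0 : I ≠ 0 := fun h => by
    rw [h, mul_zero] at hB
    exact hZ0 (le_antisymm hB zero_le)
  have hP0 : P ≠ 0 := by
    refine (lt_of_lt_of_le ?_ hPle).ne'
    have h1 : ENNReal.ofReal (C * Real.exp (-(3 * ε))) ≠ 0 := by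
      rw [Ne, ENNReal.ofReal_eq_zero, not_le]; positivity
    have h2 : (k : ℝ≥0∞) ≠ 0 := by exact_mod_cast hk0.ne'
    exact pos_iff_ne_zero.2 (mul_ne_zero h2 (mul_ne_zero h1 hI0))
  refine ⟨pos_iff_ne_zero.2 hP0, ?_⟩
  -- Here `k` and `C` cancel: one `a` comes from `hA`, one from `hB`, and the third bounds the
  -- quotient `exp (6 * ε)` of the upper and lower local limit constants.
  have hconst : Z * (k * (ENNReal.ofReal (C * Real.exp (3 * ε)) * ENNReal.ofReal a))
      ≤ ENNReal.ofReal θ * P := by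
    calc Z * (k * (ENNReal.ofReal (C * Real.exp (3 * ε)) * ENNReal.ofReal a))
        ≤ (ENNReal.ofReal a * I) * (k * (ENNReal.ofReal (C * Real.exp (3 * ε))
            * ENNReal.ofReal a)) := by gcongr
      _ = (ENNReal.ofReal a * ENNReal.ofReal a * ENNReal.ofReal (C * Real.exp (3 * ε)))
            * (k * I) := by ring
      _ ≤ (ENNReal.ofReal θ * ENNReal.ofReal (C * Real.exp (-(3 * ε)))) * (k * I) := by
          refine mul_le_mul' ?_ le_rfl
          rw [← ENNReal.ofReal_mul ha0.le, ← ENNReal.ofReal_mul (by positivity),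
            ← ENNReal.ofReal_mul hθ0.le]
          refine ENNReal.ofReal_le_ofReal ?_
          have e : Real.exp (3 * ε) = Real.exp (6 * ε) * Real.exp (-(3 * ε)) := by
            rw [← Real.exp_add]; ring_nf
          rw [e]
          calc a * a * (C * (Real.exp (6 * ε) * Real.exp (-(3 * ε))))
              ≤ a * a * (C * (a * Real.exp (-(3 * ε)))) := by gcongr
            _ = a ^ 3 * (C * Real.exp (-(3 * ε))) := by ring
            _ ≤ _ := by gcongr
      _ = ENNReal.ofReal θ * (k * (ENNReal.ofReal (C * Real.exp (-(3 * ε))) * I)) := by ring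
      _ ≤ _ := by gcongr
  have hfin := inv_mul_le_mul_inv hP0 hPt hZ0 hZt hconst
  have hnum := setLIntegral_boxRegion_le lam V hV r k hk _ _ hup
  rw [lintegral_const_mul' _ _ ENNReal.ofReal_ne_top] at hnum
  calc _ ≤ P⁻¹ * ∫⁻ y in {y | stdVec lam y ∈ invD lam '' boxRegion V r},
        ENNReal.ofReal (Real.exp (g (‖stdVec lam y‖ ^ 2))) ∂(poissonLaw lam) :=
        setLIntegral_condLaw_le _ _ _ _
    _ ≤ P⁻¹ * (k * (ENNReal.ofReal (C * Real.exp (3 * ε)) * A)) :=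
        mul_le_mul' le_rfl ((lintegral_mono_set hset).trans hnum)
    _ ≤ P⁻¹ * (k * (ENNReal.ofReal (C * Real.exp (3 * ε)) *
          (ENNReal.ofReal (a * (θ ^ s)⁻¹) * B))) := by gcongr
    _ = (P⁻¹ * (k * (ENNReal.ofReal (C * Real.exp (3 * ε)) * ENNReal.ofReal a)))
          * (ENNReal.ofReal ((θ ^ s)⁻¹) * B) := by
        rw [ENNReal.ofReal_mul ha0.le]; ring
    _ ≤ (ENNReal.ofReal θ * Z⁻¹) * (ENNReal.ofReal ((θ ^ s)⁻¹) * B) := by gcongr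
    _ = ENNReal.ofReal θ * (Z⁻¹ * (ENNReal.ofReal ((θ ^ s)⁻¹) * B)) := by rw [mul_assoc]
    _ ≤ _ := mul_le_mul' le_rfl (le_setLIntegral_limitNormal lam V hΦ g θ hθ0 r)

theorem mainTheorem2 {q s : ℕ} (τ : ℝ) (hτ : 0 < τ)
    (V : Fin s → Fin q → ℤ) (hV : LinearIndependent ℝ fun a => intVec (V a))
    (g : ℝ → ℝ) (hg_unif : UniformContinuousOn g (Set.Ici 0)) (hg_mono : MonotoneOn g (Set.Ici 0))
    (θ : ℝ) (hθ : 1 < θ) :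
    ∃ δ : ℝ, 0 < δ ∧ ∃ η : ℝ, 0 < η ∧ ∃ ν₀ : ℝ, ∀ lam : Fin q → ℝ≥0,
      ν₀ ≤ totalMean lam →
      (∀ i, τ * totalMean lam ≤ (lam i : ℝ)) →
      (∃ m : Fin q → ℤ, intVec m - meanVec lam ∈ latticeSpan V) →
      0 < poissonLaw lam (linearEvent lam (latticeSpan V)) ∧
      ∃ Lδ : Set (EuclideanSpace ℝ (Fin q)),
        Lδ = boxRegion V (η * totalMean lam) ∧
        Lδ ⊆ (latticeSpan V : Set (EuclideanSpace ℝ (Fin q))) ∧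
        {x : EuclideanSpace ℝ (Fin q) | x ∈ (latticeSpan V).map (invD lam) ∧
          ‖x‖ ≤ δ * Real.sqrt (totalMean lam)} ⊆ invD lam '' Lδ ∧
        ∫⁻ y in {y | stdVec lam y ∈ invD lam '' Lδ},
            ENNReal.ofReal (Real.exp (g (‖stdVec lam y‖ ^ 2))) ∂(condLaw lam (latticeSpan V))
          ≤ ENNReal.ofReal θ *
            ∫⁻ x in {x | θ • x ∈ invD lam '' Lδ},
              ENNReal.ofReal (Real.exp (g (θ ^ 2 * ‖x‖ ^ 2)))
                ∂(limitNormal lam (latticeSpan V)) := by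
  obtain ⟨a, ha, haθ⟩ : ∃ a : ℝ, 1 < a ∧ a ^ 3 ≤ θ := by
    refine ⟨θ ^ ((3 : ℕ) : ℝ)⁻¹, Real.one_lt_rpow hθ (by norm_num), ?_⟩
    rw [Real.rpow_inv_natCast_pow (by linarith) (by norm_num)]
  obtain ⟨εA, hεA, hεA1, RA, hRA, HA⟩ := exists_setLIntegral_exp_le s θ hθ a ha
  obtain ⟨εB, hεB, RB, hRB, HB⟩ := exists_gaussMass_le s a ha
  have hloga : 0 < Real.log a := Real.log_pos ha
  obtain ⟨ε, hε, hε1, hεa, hεA', hεB'⟩ : ∃ ε : ℝ, 0 < ε ∧ ε ≤ 1 ∧ Real.exp (6 * ε) ≤ a ∧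
      4 * ε ≤ εA ∧ 4 * ε ≤ εB := by
    refine ⟨min (Real.log a / 6) (min (εA / 4) (εB / 4)), by positivity, ?_, ?_, ?_, ?_⟩
    · exact (min_le_right _ _).trans ((min_le_left _ _).trans (by linarith))
    · rw [← Real.le_log_iff_exp_le (by linarith)]
      linarith [min_le_left (Real.log a / 6) (min (εA / 4) (εB / 4))]
    · linarith [(min_le_right (Real.log a / 6) _).trans (min_le_left (εA / 4) (εB / 4))]
    · linarith [(min_le_right (Real.log a / 6) _).trans (min_le_right (εA / 4) (εB / 4))]
  obtain ⟨δP, hδP, hδP', M, hM, HP⟩ := exists_poissonLaw_singleton_bounds q ε hε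
  obtain ⟨ρ₁, hρ₁, Hg⟩ := exists_modulus_sq g hg_unif hg_mono ε hε
  -- With `g = id` the same lemma controls the change of the quadratic exponent itself.
  obtain ⟨ρ₂, hρ₂, Hid⟩ := exists_modulus_sq id uniformContinuous_id.uniformContinuousOn
    (monotone_id.monotoneOn _) ε hε
  obtain ⟨K, hK, HK⟩ := exists_norm_latticeMap_le V
  obtain ⟨K', hK', HK'⟩ := exists_norm_le_latticeMap V hV
  set ρ := min ρ₁ ρ₂ with hρ
  have hρ0 : 0 < ρ := by positivity
  set R := max RA RB with hR
  have hR0 : 0 < R := lt_of_lt_of_le hRA (le_max_left _ _)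
  -- In the region `‖t‖ ≤ η * ν + 1 ≤ 2 * η * ν`, so each coordinate deviates by at most `δP * τ * ν
  -- ≤ δP * lam i`, the range of the local limit bound.
  set η := δP * τ / (2 * K) with hη
  have hη0 : 0 < η := by positivity
  -- Then `‖Φ t‖ ≤ δ * √ν` forces `‖t‖ ≤ η * ν / 2`; the other half of `η * ν` is at least 1 and
  -- covers the rounding by floors.
  set δ := η / (2 * K') with hδ
  have hδ0 : 0 < δ := by positivity
  -- The summands ensure in turn: `ν > 0`; every mean is at least `M`; a unit step in `t` moves `Φ
  -- t` by at most `ρ`; `η * ν ≥ 2`; and the ball of radius `R` lies in the region.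
  refine ⟨δ, hδ0, η, hη0, 1 + M / τ + (K / ρ) ^ 2 / τ + 2 / η + (R / δ) ^ 2,
    fun lam hν hlam hm => ?_⟩
  set ν := totalMean lam with hνdef
  have p1 : 0 < M / τ := by positivity
  have p2 : 0 < (K / ρ) ^ 2 / τ := by positivity
  have p3 : 0 < 2 / η := by positivity
  have p4 : 0 < (R / δ) ^ 2 := by positivity
  have hν0 : 0 < ν := by linarith
  have hνM : M ≤ τ * ν := by
    rw [← div_le_iff₀' hτ]; linarith
  have hνK : (K / ρ) ^ 2 ≤ τ * ν := by
    rw [← div_le_iff₀' hτ]; linarith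
  have hνη : 2 ≤ η * ν := by
    rw [← div_le_iff₀' hη0]; linarith
  have hνR : R ≤ δ * √ν := by
    rw [← div_le_iff₀' hδ0]; exact Real.le_sqrt_of_sq_le (by linarith)
  have hτν : 0 < τ * ν := by positivity
  have hpos : ∀ i, 0 < lam i := fun i => by exact_mod_cast hτν.trans_le (hlam i)
  have hinvD := invD_injective lam hpos
  have hΦ : Function.Injective (stdLatticeMap lam V) := hinvD.comp (latticeMap_injective V hV)
  have hΦK : ∀ t, ‖stdLatticeMap lam V t‖ ≤ ρ * ‖t‖ := fun t => by
    calc ‖stdLatticeMap lam V t‖ ≤ ‖latticeMap V t‖ / √(τ * ν) := norm_invD_le lam _ hτν hlam _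
      _ ≤ K * ‖t‖ / (K / ρ) := by
          have : K / ρ ≤ √(τ * ν) := Real.le_sqrt_of_sq_le hνK
          gcongr
          exact HK t
      _ = _ := by field_simp
  have hcube : ∀ t, ‖stdLatticeMap lam V t‖ ≤ δ * √ν → t ∈ cubeRegion s (η * ν) := by
    intro t ht
    refine mem_cubeRegion_of_norm_le ?_
    have h1 : ‖t‖ ≤ η * ν / 2 := by
      calc ‖t‖ ≤ K' * ‖latticeMap V t‖ := HK' t
        _ ≤ K' * (√ν * ‖stdLatticeMap lam V t‖) := by
            gcongr; exact norm_le_invD lam hpos _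
        _ ≤ K' * (√ν * (δ * √ν)) := by gcongr
        _ = K' * δ * (√ν * √ν) := by ring
        _ = η * ν / 2 := by
            rw [Real.mul_self_sqrt hν0.le, hδ]; field_simp
    linarith
  have hbound : ∀ t ∈ cubeRegion s (η * ν), ∀ i, |latticeMap V t i| ≤ δP * lam i := by
    intro t ht i
    calc |latticeMap V t i| ≤ ‖latticeMap V t‖ := PiLp.norm_apply_le (latticeMap V t) i
      _ ≤ K * ‖t‖ := HK t
      _ ≤ K * (2 * (η * ν)) := by
          have := norm_le_of_mem_cubeRegion (by positivity) ht
          gcongr; linarith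
      _ = δP * (τ * ν) := by rw [hη]; field_simp
      _ ≤ _ := by gcongr; exact hlam i
  obtain ⟨k, hk0, hk⟩ := exists_encard_boxCounts lam V (η * ν) hm (by
    intro x hx i
    rw [boxRegion_eq_image] at hx
    obtain ⟨t, ht, rfl⟩ := hx
    have h1 := (abs_le.1 (hbound t ht i)).1
    have h2 : (0 : ℝ) < lam i := hpos i
    nlinarith)
  have hclose : ∀ t ∈ cubeRegion s (η * ν), ∀ y ∈ boxCounts lam V (fun a => ⌊t a⌋),
      |‖stdVec lam y‖ - ‖stdLatticeMap lam V t‖| ≤ ρ ∧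
        ∀ i, |(y i : ℝ) - lam i| ≤ δP * lam i := by
    intro t ht y hy
    simp only [boxCounts, latticeBox_eq_image, Set.mem_ofPred_eq] at hy
    obtain ⟨u, hu, e⟩ := hy
    have hu' : u ∈ cubeRegion s (η * ν) := fun a => by rw [hu a]; exact ht a
    constructor
    -- The count vector has coordinates `u` in the same unit cube as `t`, so `‖u - t‖ ≤ 1`.
    · have e' : stdVec lam y = stdLatticeMap lam V u := by rw [stdVec, ← e]; rfl
      rw [e']
      refine (abs_norm_sub_norm_le _ _).trans ?_
      rw [← map_sub]
      refine (hΦK _).trans ?_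
      nlinarith [norm_sub_le_one_of_floor_eq hu]
    · intro i
      have h1 := hbound u hu' i
      rw [e] at h1
      simpa [countVec, meanVec] using h1
  have hmain := setLIntegral_condLaw_le_limitNormal lam V hV hinvD g θ a ε εA εB (η * ν)
    (gaussNorm lam) ha haθ hεa (gaussNorm_pos lam) k hk0 hk ?_ ?_
    (HA q _ g hg_mono hg_unif.continuousOn _ (measurableSet_cubeRegion _)
      fun t ht => hcube t (ht.trans ((le_max_left _ _).trans hνR)))
    (HB q _ _ (measurableSet_cubeRegion _) (lintegral_subspaceGaussian_range _ hΦ).2.1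
      fun t ht => hcube t (ht.trans ((le_max_right _ _).trans hνR)))
  · refine ⟨hmain.1, _, rfl, boxRegion_subset_latticeSpan V _, ?_, hmain.2⟩
    rintro x ⟨hx, hxn⟩
    rw [← range_stdLatticeMap] at hx
    obtain ⟨t, rfl⟩ := hx
    rw [invD_image_boxRegion]
    exact Set.mem_image_of_mem _ (hcube t hxn)
  · intro t ht y hy
    obtain ⟨h1, h2⟩ := hclose t ht y hy
    have h3 := (HP lam y (fun i => hνM.trans (hlam i)) h2).1
    refine (mul_le_mul' le_rfl h3).trans ?_
    have hG := gaussNorm_pos lam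
    rw [← ENNReal.ofReal_mul (by positivity), ← ENNReal.ofReal_mul (by positivity)]
    refine ENNReal.ofReal_le_ofReal ?_
    have e1 := Hg _ _ (norm_nonneg _) (norm_nonneg _) (h1.trans (min_le_left _ _))
    have e2 := Hid _ _ (norm_nonneg _) (norm_nonneg _)
      ((abs_sub_comm _ _).le.trans (h1.trans (min_le_right _ _)))
    have e3 := exponent_le hε hε1 hεA' e2 e1
    rw [mul_left_comm, mul_assoc, ← Real.exp_add, ← Real.exp_add]
    refine mul_le_mul_of_nonneg_left (Real.exp_le_exp.2 e3) hG.le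
  · intro t ht y hy
    obtain ⟨h1, h2⟩ := hclose t ht y hy
    have h3 := (HP lam y (fun i => hνM.trans (hlam i)) h2).2
    refine le_trans ?_ h3
    have hG := gaussNorm_pos lam
    rw [← ENNReal.ofReal_mul (by positivity), mul_assoc, ← Real.exp_add]
    refine ENNReal.ofReal_le_ofReal ?_
    have e2 := Hid _ _ (norm_nonneg _) (norm_nonneg _) (h1.trans (min_le_right _ _))
    have e3 := le_exponent hε hε1 hεB' e2
    refine mul_le_mul_of_nonneg_left (Real.exp_le_exp.2 e3) hG.le
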